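/- **Proposition 2.9.** Let $n\ge 2$ and let $M$ be a smooth manifold of dimension $4n$ with an almost hypercomplex NH-metric structure, that is, with smooth endomorphism fields $J_1,J_2,J_3$ of $TM$ and a smooth pseudo-Riemannian metric $g$ such that, for all cyclic permutations $(\alpha,\beta,\gamma)$ of $(1,2,3)$, $$J_\alpha=J_\beta J_\gamma=-J_\gamma J_\beta,\qquad J_\alpha^2=-I,\qquad g(x,y)=\varepsilon_\alpha\, g(J_\alpha x,J_\alpha y),\qquad \varepsilon_1=1,\ \varepsilon_2=\varepsilon_3=-1 .$$ (Such a metric is automatically of neutral signature $(2n,2n)$.) Let $\nabla$ be the Levi-Civita connection of $g$, $R(x,y)z=[\nabla_x,\nabla_y]z-\nabla_{[x,y]}z$ its curvature, $\rho(y,z)=g^{ij}g(R(e_i,y)z,e_j)$ the Ricci tensor and $\tau=g^{ij}\rho(e_i,e_j)$ the scalar curvature. The structure is called quaternionic Kähler if the bundle $Q=\operatorname{span}(J_1,J_2,J_3)\subset\operatorname{End}(TM)$ is parallel, i.e. $\nabla_xJ_\alpha\in Q$ for all tangent vectors $x$ and $\alpha=1,2,3$. 1. The structure is quaternionic Kähler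 if and only if every point of $M$ has an open neighbourhood $U$ with smooth 1-forms $\omega_1,\omega_2,\omega_3$ on $U$ such that $$(\nabla_xJ_\alpha)y=\omega_\gamma(x)J_\beta y-\omega_\beta(x)J_\gamma y\qquad(*)$$ for all cyclic permutations $(\alpha,\beta,\gamma)$ of $(1,2,3)$. 2. On every open set $U\subset M$ there is at most one triple of smooth 1-forms satisfying $(*)$, and any such triple satisfies, at all points of $U$ and for all tangent vectors $x,y$, $$d\omega_2(x,y)=-\omega_3(x)\omega_1(y)+\omega_1(x)\omega_3(y),$$ $$d\omega_3(x,y)=-\omega_1(x)\omega_2(y)+\omega_2(x)\omega_1(y),$$ $$d\omega_1(x,y)=-\omega_2(x)\omega_3(y)+\omega_3(x)\omega_2(y)-\frac{\tau}{4n^2}\,g(J_1x,y),$$ where $d\omega(X,Y)=X(\omega(Y))-Y(\omega(X))-\omega([X,Y])$. -/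

import Mathlib

open Bundle FiberBundle VectorField NormedSpace
open scoped Manifold ContDiff Topology

noncomputable section

namespace NHManifold

/-! ### Pseudo-Riemannian metrics and their Levi-Civita connection -/

section LeviCivita

variable {E : Type*} [NormedAddCommGroup E] [NormedSpace ℝ E]
  {M : Type*} [TopologicalSpace M] [ChartedSpace E M] [IsManifold 𝓘(ℝ, E) ∞ M]

variable (E M) in
/-- A smooth pseudo-Riemannian metric on `M`: a smooth field of symmetric nondegenerate bilinear
forms on the tangent spaces (of arbitrary signature). -/
structure PseudoRiemannianMetric where
  val (x : M) : TangentSpace 𝓘(ℝ, E) x →L[ℝ] TangentSpace 𝓘(ℝ, E) x →L[ℝ] ℝ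
  symm (x : M) (v w : TangentSpace 𝓘(ℝ, E) x) : val x v w = val x w v
  nondegenerate (x : M) (v : TangentSpace 𝓘(ℝ, E) x) : (∀ w, val x v w = 0) → v = 0
  contMDiff : ContMDiff 𝓘(ℝ, E) (𝓘(ℝ, E).prod 𝓘(ℝ, E →L[ℝ] E →L[ℝ] ℝ)) ∞
    (fun x ↦ TotalSpace.mk' (E →L[ℝ] E →L[ℝ] ℝ)
      (E := fun x : M ↦
        (TangentSpace 𝓘(ℝ, E) x →L[ℝ] TangentSpace 𝓘(ℝ, E) x →L[ℝ] ℝ)) x (val x))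

/-- The right-hand side of the Koszul formula for `2 g(∇_X Y, Z)` at `x`. -/
def koszul (g : PseudoRiemannianMetric E M) (X Y Z : Π x : M, TangentSpace 𝓘(ℝ, E) x) (x : M) : ℝ :=
  d% (fun p ↦ g.val p (Y p) (Z p)) x (X x)
    + d% (fun p ↦ g.val p (Z p) (X p)) x (Y x)
    - d% (fun p ↦ g.val p (X p) (Y p)) x (Z x)
    + g.val x (mlieBracket 𝓘(ℝ, E) X Y x) (Z x)
    - g.val x (mlieBracket 𝓘(ℝ, E) Y Z x) (X x)
    + g.val x (mlieBracket 𝓘(ℝ, E) Z X x) (Y x)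

theorem mdifferentiableAt_metric (g : PseudoRiemannianMetric E M)
    {X Y : Π x : M, TangentSpace 𝓘(ℝ, E) x} {x : M}
    (hX : MDiffAt (T% X) x) (hY : MDiffAt (T% Y) x) :
    MDiffAt (fun p ↦ g.val p (X p) (Y p)) x := by
  have h1 : MDifferentiableAt 𝓘(ℝ, E) (𝓘(ℝ, E).prod 𝓘(ℝ, E →L[ℝ] E →L[ℝ] ℝ))
      (fun x ↦ TotalSpace.mk' (E →L[ℝ] E →L[ℝ] ℝ)
      (E := fun x : M ↦
        (TangentSpace 𝓘(ℝ, E) x →L[ℝ] TangentSpace 𝓘(ℝ, E) x →L[ℝ] ℝ)) x (g.val x)) x :=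
    g.contMDiff.mdifferentiableAt (by simp)
  have : MDifferentiableAt 𝓘(ℝ, E) (𝓘(ℝ, E).prod 𝓘(ℝ))
      (fun m ↦ TotalSpace.mk' ℝ (E := Bundle.Trivial M ℝ) m (g.val m (X m) (Y m))) x := by
    apply MDifferentiableAt.clm_bundle_apply₂ (F₁ := E) (F₂ := E)
    · exact h1
    · exact hX
    · exact hY
  simp only [mdifferentiableAt_totalSpace] at this
  exact this.2

theorem mvfderiv_metric_smul_left (g : PseudoRiemannianMetric E M) {f : M → ℝ}
    {X Y : Π x : M, TangentSpace 𝓘(ℝ, E) x} {x : M} (hf : MDiffAt f x)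
    (hX : MDiffAt (T% X) x) (hY : MDiffAt (T% Y) x) (v : TangentSpace 𝓘(ℝ, E) x) :
    d% (fun p ↦ g.val p ((f • X) p) (Y p)) x v
      = f x * d% (fun p ↦ g.val p (X p) (Y p)) x v + d% f x v * g.val x (X x) (Y x) := by
  have e : (fun p ↦ g.val p ((f • X) p) (Y p)) = f * fun p ↦ g.val p (X p) (Y p) := by
    ext p; simp
  rw [e, mvfderiv_mul hf (mdifferentiableAt_metric g hX hY)]
  simp [mul_comm]

theorem mvfderiv_metric_add_left (g : PseudoRiemannianMetric E M)
    {X X' Y : Π x : M, TangentSpace 𝓘(ℝ, E) x} {x : M}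
    (hX : MDiffAt (T% X) x) (hX' : MDiffAt (T% X') x) (hY : MDiffAt (T% Y) x)
    (v : TangentSpace 𝓘(ℝ, E) x) :
    d% (fun p ↦ g.val p ((X + X') p) (Y p)) x v
      = d% (fun p ↦ g.val p (X p) (Y p)) x v + d% (fun p ↦ g.val p (X' p) (Y p)) x v := by
  have e : (fun p ↦ g.val p ((X + X') p) (Y p))
      = (fun p ↦ g.val p (X p) (Y p)) + fun p ↦ g.val p (X' p) (Y p) := by
    ext p; simp
  rw [e, mvfderiv_add (mdifferentiableAt_metric g hX hY) (mdifferentiableAt_metric g hX' hY)]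
  simp

theorem metric_comm (g : PseudoRiemannianMetric E M) (X Y : Π x : M, TangentSpace 𝓘(ℝ, E) x) :
    (fun p ↦ g.val p (X p) (Y p)) = fun p ↦ g.val p (Y p) (X p) :=
  funext fun p ↦ g.symm p _ _

/-- `g(∇_X Y, Z)` and `g(∇_Y X, Z)` differ by `g([X, Y], Z)`. -/
theorem koszul_swap_left (g : PseudoRiemannianMetric E M)
    (X Y Z : Π x : M, TangentSpace 𝓘(ℝ, E) x) (x : M) :
    koszul g X Y Z x = koszul g Y X Z x + 2 * g.val x (mlieBracket 𝓘(ℝ, E) X Y x) (Z x) := by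
  unfold koszul
  rw [metric_comm g Y Z, metric_comm g Z X, metric_comm g X Y,
    mlieBracket_swap_apply (V := Y) (W := X), mlieBracket_swap_apply (V := X) (W := Z),
    mlieBracket_swap_apply (V := Z) (W := Y)]
  simp only [map_neg, _root_.neg_apply]
  ring

/-- `X g(Y, Z) = g(∇_X Y, Z) + g(∇_X Z, Y)`. -/
theorem koszul_swap_right (g : PseudoRiemannianMetric E M)
    (X Y Z : Π x : M, TangentSpace 𝓘(ℝ, E) x) (x : M) :
    koszul g X Y Z x + koszul g X Z Y x = 2 * d% (fun p ↦ g.val p (Y p) (Z p)) x (X x) := by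
  unfold koszul
  rw [metric_comm g Z Y, metric_comm g Z X, metric_comm g X Y,
    mlieBracket_swap_apply (V := Z) (W := Y), mlieBracket_swap_apply (V := Y) (W := X),
    mlieBracket_swap_apply (V := X) (W := Z)]
  simp only [map_neg, _root_.neg_apply]
  ring

theorem eq_of_val_eq (g : PseudoRiemannianMetric E M) {x : M} {v w : TangentSpace 𝓘(ℝ, E) x}
    (h : ∀ Z : Π x : M, TangentSpace 𝓘(ℝ, E) x, MDiffAt (T% Z) x →
      g.val x v (Z x) = g.val x w (Z x)) : v = w := by
  rw [← sub_eq_zero]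
  refine g.nondegenerate x _ fun z ↦ ?_
  have := h (extend E z) (mdifferentiableAt_extend ..)
  rw [extend_apply_self] at this
  simp [this]

variable [FiniteDimensional ℝ E]

theorem koszul_smul_left (g : PseudoRiemannianMetric E M) {f : M → ℝ}
    {X Y Z : Π x : M, TangentSpace 𝓘(ℝ, E) x} {x : M} (hf : MDiffAt f x)
    (hX : MDiffAt (T% X) x) (hY : MDiffAt (T% Y) x) (hZ : MDiffAt (T% Z) x) :
    koszul g (f • X) Y Z x = f x * koszul g X Y Z x := by
  unfold koszul
  rw [metric_comm g Z (f • X), metric_comm g Z X, mvfderiv_metric_smul_left g hf hX hZ,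
    mvfderiv_metric_smul_left g hf hX hY, mlieBracket_smul_left hf hX,
    mlieBracket_smul_right hf hX]
  simp only [Pi.smul_apply', map_smul, map_add, _root_.add_apply,
    _root_.smul_apply, smul_eq_mul]
  ring

theorem koszul_add_left (g : PseudoRiemannianMetric E M)
    {X X' Y Z : Π x : M, TangentSpace 𝓘(ℝ, E) x} {x : M}
    (hX : MDiffAt (T% X) x) (hX' : MDiffAt (T% X') x)
    (hY : MDiffAt (T% Y) x) (hZ : MDiffAt (T% Z) x) :
    koszul g (X + X') Y Z x = koszul g X Y Z x + koszul g X' Y Z x := by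
  unfold koszul
  rw [metric_comm g Z (X + X'), metric_comm g Z X, metric_comm g Z X',
    mvfderiv_metric_add_left g hX hX' hZ,
    mvfderiv_metric_add_left g hX hX' hY, mlieBracket_add_left hX hX',
    mlieBracket_add_right hX hX']
  simp only [Pi.add_apply, map_add, _root_.add_apply]
  ring

theorem koszul_smul_middle (g : PseudoRiemannianMetric E M) {f : M → ℝ}
    {X Y Z : Π x : M, TangentSpace 𝓘(ℝ, E) x} {x : M} (hf : MDiffAt f x)
    (hX : MDiffAt (T% X) x) (hY : MDiffAt (T% Y) x) (hZ : MDiffAt (T% Z) x) :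
    koszul g X (f • Y) Z x
      = f x * koszul g X Y Z x + 2 * (d% f x (X x) * g.val x (Y x) (Z x)) := by
  rw [koszul_swap_left, koszul_smul_left g hf hY hX hZ, koszul_swap_left g X Y Z,
    mlieBracket_smul_right hf hY]
  simp only [map_smul, map_add, _root_.add_apply,
    _root_.smul_apply, smul_eq_mul]
  ring

theorem koszul_add_middle (g : PseudoRiemannianMetric E M)
    {X Y Y' Z : Π x : M, TangentSpace 𝓘(ℝ, E) x} {x : M}
    (hX : MDiffAt (T% X) x) (hY : MDiffAt (T% Y) x) (hY' : MDiffAt (T% Y') x)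
    (hZ : MDiffAt (T% Z) x) :
    koszul g X (Y + Y') Z x = koszul g X Y Z x + koszul g X Y' Z x := by
  rw [koszul_swap_left, koszul_add_left g hY hY' hX hZ, koszul_swap_left g X Y Z,
    koszul_swap_left g X Y' Z, mlieBracket_add_right hY hY']
  simp only [map_add, _root_.add_apply]
  ring

theorem tensorialAt_koszul_left (g : PseudoRiemannianMetric E M)
    {Y Z : Π x : M, TangentSpace 𝓘(ℝ, E) x} {x : M}
    (hY : MDiffAt (T% Y) x) (hZ : MDiffAt (T% Z) x) :
    TensorialAt 𝓘(ℝ, E) E (fun X ↦ koszul g X Y Z x) x where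
  smul hf hX := koszul_smul_left g hf hX hY hZ
  add hX hX' := koszul_add_left g hX hX' hY hZ

theorem tensorialAt_koszul_right (g : PseudoRiemannianMetric E M)
    {X Y : Π x : M, TangentSpace 𝓘(ℝ, E) x} {x : M}
    (hX : MDiffAt (T% X) x) (hY : MDiffAt (T% Y) x) :
    TensorialAt 𝓘(ℝ, E) E (fun Z ↦ koszul g X Y Z x) x where
  smul {f Z} hf hZ := by
    have h := koszul_swap_right g X (f • Z) Y x
    rw [koszul_smul_middle g hf hX hZ hY, mvfderiv_metric_smul_left g hf hZ hY] at h
    have h' := koszul_swap_right g X Z Y x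
    simp only [smul_eq_mul]
    linear_combination h - f x * h'
  add {Z Z'} hZ hZ' := by
    have h := koszul_swap_right g X (Z + Z') Y x
    rw [koszul_add_middle g hX hZ hZ' hY, mvfderiv_metric_add_left g hZ hZ' hY] at h
    linear_combination h - koszul_swap_right g X Z Y x - koszul_swap_right g X Z' Y x

/-- The musical isomorphism `v ↦ g(v, ·)`. -/
def flat (g : PseudoRiemannianMetric E M) (x : M) :
    TangentSpace 𝓘(ℝ, E) x ≃ₗ[ℝ] (TangentSpace 𝓘(ℝ, E) x →L[ℝ] ℝ) :=
  haveI : FiniteDimensional ℝ (TangentSpace 𝓘(ℝ, E) x) := inferInstanceAs (FiniteDimensional ℝ E)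
  LinearMap.linearEquivOfInjective (g.val x).toLinearMap
    (by
      rw [← LinearMap.ker_eq_bot, LinearMap.ker_eq_bot']
      intro v hv
      exact g.nondegenerate x v fun w ↦ congr($hv w))
    (by
      have : T2Space (TangentSpace 𝓘(ℝ, E) x) := inferInstanceAs (T2Space E)
      rw [← Subspace.dual_finrank_eq (K := ℝ)]
      exact (LinearMap.toContinuousLinearMap (𝕜 := ℝ) (E := TangentSpace 𝓘(ℝ, E) x)
        (F' := ℝ)).finrank_eq)

theorem val_flat_symm (g : PseudoRiemannianMetric E M) (x : M)
    (φ : TangentSpace 𝓘(ℝ, E) x →L[ℝ] ℝ) (w : TangentSpace 𝓘(ℝ, E) x) :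
    g.val x ((flat g x).symm φ) w = φ w := by
  have : flat g x ((flat g x).symm φ) = φ := (flat g x).apply_symm_apply φ
  exact congr($this w)

open scoped Classical in
/-- The Levi-Civita derivative: at a point where the vector field `Y` is differentiable, `∇_v Y` is
the vector determined by the Koszul formula. -/
def leviCivitaFun (g : PseudoRiemannianMetric E M) (Y : Π x : M, TangentSpace 𝓘(ℝ, E) x) (x : M) :
    TangentSpace 𝓘(ℝ, E) x →L[ℝ] TangentSpace 𝓘(ℝ, E) x :=
  if hY : MDiffAt (T% Y) x then
    haveI : FiniteDimensional ℝ (TangentSpace 𝓘(ℝ, E) x) := inferInstanceAs (FiniteDimensional ℝ E)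
    haveI : T2Space (TangentSpace 𝓘(ℝ, E) x) := inferInstanceAs (T2Space E)
    LinearMap.toContinuousLinearMap ((flat g x).symm.toLinearMap ∘ₗ
      ((1 / 2 : ℝ) • TensorialAt.mkHom₂ (I := 𝓘(ℝ, E)) (F := E) (F' := E)
        (fun X Z ↦ koszul g X Y Z x) x
        (fun _ hZ ↦ tensorialAt_koszul_left g hY hZ)
        (fun _ hX ↦ tensorialAt_koszul_right g hX hY)).toLinearMap)
  else 0

theorem val_leviCivitaFun (g : PseudoRiemannianMetric E M)
    {X Y Z : Π x : M, TangentSpace 𝓘(ℝ, E) x} {x : M}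
    (hX : MDiffAt (T% X) x) (hY : MDiffAt (T% Y) x) (hZ : MDiffAt (T% Z) x) :
    2 * g.val x (leviCivitaFun g Y x (X x)) (Z x) = koszul g X Y Z x := by
  rw [leviCivitaFun, dif_pos hY]
  simp only [LinearMap.coe_toContinuousLinearMap', LinearMap.comp_apply, LinearEquiv.coe_coe,
    ContinuousLinearMap.coe_coe, val_flat_symm, _root_.smul_apply, smul_eq_mul]
  rw [TensorialAt.mkHom₂_apply _ _ hX hZ]
  ring

/-- The Levi-Civita connection of a pseudo-Riemannian metric. -/
def leviCivita (g : PseudoRiemannianMetric E M) :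
    CovariantDerivative 𝓘(ℝ, E) E (TangentSpace 𝓘(ℝ, E) : M → Type _) where
  toFun := leviCivitaFun g
  isCovariantDerivativeOnUniv :=
    { add := fun {Y Y' x} hY hY' _ ↦ by
        ext v
        refine eq_of_val_eq g fun Z hZ ↦ ?_
        have hX := mdifferentiableAt_extend 𝓘(ℝ, E) E v
        have h := val_leviCivitaFun g hX (mdifferentiableAt_add_section hY hY') hZ
        rw [koszul_add_middle g hX hY hY' hZ, ← val_leviCivitaFun g hX hY hZ,
          ← val_leviCivitaFun g hX hY' hZ, extend_apply_self] at h
        simp only [_root_.add_apply, map_add]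
        linarith
      leibniz := fun {Y f x} hY hf _ ↦ by
        ext v
        refine eq_of_val_eq g fun Z hZ ↦ ?_
        have hX := mdifferentiableAt_extend 𝓘(ℝ, E) E v
        have h := val_leviCivitaFun g hX (hf.smul_section hY) hZ
        rw [koszul_smul_middle g hf hX hY hZ, ← val_leviCivitaFun g hX hY hZ,
          extend_apply_self] at h
        simp only [_root_.add_apply, map_add, _root_.smul_apply, map_smul,
          ContinuousLinearMap.smulRight_apply, smul_eq_mul]
        linarith }

/-- The Levi-Civita connection is compatible with the metric. -/
theorem leviCivita_metric (g : PseudoRiemannianMetric E M)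
    {X Y Z : Π x : M, TangentSpace 𝓘(ℝ, E) x} {x : M}
    (hX : MDiffAt (T% X) x) (hY : MDiffAt (T% Y) x) (hZ : MDiffAt (T% Z) x) :
    d% (fun p ↦ g.val p (Y p) (Z p)) x (X x)
      = g.val x (leviCivita g Y x (X x)) (Z x) + g.val x (Y x) (leviCivita g Z x (X x)) := by
  have h := koszul_swap_right g X Y Z x
  rw [← val_leviCivitaFun g hX hY hZ, ← val_leviCivitaFun g hX hZ hY] at h
  rw [g.symm x (Y x)]
  change _ = g.val x (leviCivitaFun g Y x (X x)) (Z x) + g.val x (leviCivitaFun g Z x (X x)) (Y x)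
  linarith

/-- The Levi-Civita connection is torsion-free. -/
theorem leviCivita_torsion (g : PseudoRiemannianMetric E M)
    {X Y : Π x : M, TangentSpace 𝓘(ℝ, E) x} {x : M}
    (hX : MDiffAt (T% X) x) (hY : MDiffAt (T% Y) x) :
    leviCivita g Y x (X x) - leviCivita g X x (Y x) = mlieBracket 𝓘(ℝ, E) X Y x := by
  refine eq_of_val_eq g fun Z hZ ↦ ?_
  have h := koszul_swap_left g X Y Z x
  rw [← val_leviCivitaFun g hX hY hZ, ← val_leviCivitaFun g hY hX hZ] at h
  change g.val x (leviCivitaFun g Y x (X x) - leviCivitaFun g X x (Y x)) (Z x) = _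
  simp only [map_sub, _root_.sub_apply]
  linarith

end LeviCivita

/-! ### Covariant derivatives of endomorphisms, curvature, traces, exterior derivative -/

section Tensors

variable {E : Type*} [NormedAddCommGroup E] [NormedSpace ℝ E] [FiniteDimensional ℝ E]
  {M : Type*} [TopologicalSpace M] [ChartedSpace E M] [IsManifold 𝓘(ℝ, E) ∞ M]

/-- Smoothness of a field of endomorphisms of the tangent spaces. -/
def SmoothEnd (J : Π x : M, TangentSpace 𝓘(ℝ, E) x →L[ℝ] TangentSpace 𝓘(ℝ, E) x) : Prop :=
  ContMDiff 𝓘(ℝ, E) (𝓘(ℝ, E).prod 𝓘(ℝ, E →L[ℝ] E)) ∞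
    (fun x ↦ TotalSpace.mk' (E →L[ℝ] E)
      (E := fun x : M ↦ (TangentSpace 𝓘(ℝ, E) x →L[ℝ] TangentSpace 𝓘(ℝ, E) x)) x (J x))

/-- Smoothness of a 1-form on a set `U`. -/
def SmoothOneFormOn (om : Π x : M, TangentSpace 𝓘(ℝ, E) x →L[ℝ] ℝ) (U : Set M) : Prop :=
  ContMDiffOn 𝓘(ℝ, E) (𝓘(ℝ, E).prod 𝓘(ℝ, E →L[ℝ] ℝ)) ∞
    (fun x ↦ TotalSpace.mk' (E →L[ℝ] ℝ)
      (E := fun x : M ↦ (TangentSpace 𝓘(ℝ, E) x →L[ℝ] ℝ)) x (om x)) U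

/-- `(∇_v J) y = ∇_v (J Y) - J (∇_v Y)`, where `Y` is any differentiable vector field with
`Y x = y` (see `covDerivEnd_eq`). -/
def covDerivEnd (g : PseudoRiemannianMetric E M)
    (J : Π x : M, TangentSpace 𝓘(ℝ, E) x →L[ℝ] TangentSpace 𝓘(ℝ, E) x)
    (x : M) (v y : TangentSpace 𝓘(ℝ, E) x) : TangentSpace 𝓘(ℝ, E) x :=
  leviCivita g (fun p ↦ J p (extend E y p)) x v - J x (leviCivita g (extend E y) x v)

theorem covDerivEnd_eq (g : PseudoRiemannianMetric E M)
    {J : Π x : M, TangentSpace 𝓘(ℝ, E) x →L[ℝ] TangentSpace 𝓘(ℝ, E) x} (hJ : SmoothEnd J)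
    {x : M} (v : TangentSpace 𝓘(ℝ, E) x) {Y : Π x : M, TangentSpace 𝓘(ℝ, E) x}
    (hY : MDiffAt (T% Y) x) :
    covDerivEnd g J x v (Y x)
      = leviCivita g (fun p ↦ J p (Y p)) x v - J x (leviCivita g Y x v) := by
  have hJY : ∀ {Y : Π x : M, TangentSpace 𝓘(ℝ, E) x}, MDiffAt (T% Y) x →
      MDiffAt (T% (fun p ↦ J p (Y p))) x := fun hY ↦
    MDifferentiableAt.clm_bundle_apply (F₁ := E) (F₂ := E)
      (hJ.mdifferentiableAt (by simp)) hY
  have hT : TensorialAt 𝓘(ℝ, E) E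
      (fun Y ↦ leviCivita g (fun p ↦ J p (Y p)) x v - J x (leviCivita g Y x v)) x :=
    { smul := fun {f Y} hf hY ↦ by
        have e : (fun p ↦ J p ((f • Y) p)) = f • fun p ↦ J p (Y p) := by ext p; simp
        have h1 := (leviCivita g).isCovariantDerivativeOnUniv.leibniz (hJY hY) hf
        have h2 := (leviCivita g).isCovariantDerivativeOnUniv.leibniz hY hf
        rw [e, h1, h2]
        simp only [_root_.add_apply, _root_.smul_apply,
          ContinuousLinearMap.smulRight_apply, map_add, map_smul]
        module
      add := fun {Y Y'} hY hY' ↦ by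
        have e : (fun p ↦ J p ((Y + Y') p)) = (fun p ↦ J p (Y p)) + fun p ↦ J p (Y' p) := by
          ext p; simp
        have h1 := (leviCivita g).isCovariantDerivativeOnUniv.add (hJY hY) (hJY hY')
        have h2 := (leviCivita g).isCovariantDerivativeOnUniv.add hY hY'
        rw [e, h1, h2]
        simp only [_root_.add_apply, map_add]
        abel }
  exact hT.pointwise (mdifferentiableAt_extend ..) hY (by simp)

/-- `R(X, Y)Z = ∇_X ∇_Y Z - ∇_Y ∇_X Z - ∇_[X, Y] Z` for vector fields. -/
def curvatureField (g : PseudoRiemannianMetric E M) (X Y Z : Π x : M, TangentSpace 𝓘(ℝ, E) x)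
    (x : M) : TangentSpace 𝓘(ℝ, E) x :=
  leviCivita g (fun p ↦ leviCivita g Z p (Y p)) x (X x)
    - leviCivita g (fun p ↦ leviCivita g Z p (X p)) x (Y x)
    - leviCivita g Z x (mlieBracket 𝓘(ℝ, E) X Y x)

/-- The curvature `R(u, v)w` of tangent vectors, computed with extensions of `u, v, w` that are
smooth near `x`. -/
def curvature (g : PseudoRiemannianMetric E M) (x : M) (u v w : TangentSpace 𝓘(ℝ, E) x) :
    TangentSpace 𝓘(ℝ, E) x :=
  curvatureField g (extend E u) (extend E v) (extend E w) x

/-- The trace `g^{ij} B(e_i, e_j) = ∑ B(e_i, e^i)` with respect to `g` of a bilinear form `B` on the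
tangent space at `x`; `(e_i)` is a basis, and `e^i = g^{ij} e_j` is the vector with
`g(e^i, ·)` equal to the `i`-th coordinate function. -/
def metricTrace (g : PseudoRiemannianMetric E M) (x : M)
    (B : TangentSpace 𝓘(ℝ, E) x → TangentSpace 𝓘(ℝ, E) x → ℝ) : ℝ :=
  haveI : FiniteDimensional ℝ (TangentSpace 𝓘(ℝ, E) x) := inferInstanceAs (FiniteDimensional ℝ E)
  haveI : T2Space (TangentSpace 𝓘(ℝ, E) x) := inferInstanceAs (T2Space E)
  let b := Module.finBasis ℝ (TangentSpace 𝓘(ℝ, E) x)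
  ∑ i, B (b i) ((flat g x).symm (LinearMap.toContinuousLinearMap (b.coord i)))

/-- The Ricci tensor `ρ(y, z) = g^{ij} g(R(e_i, y)z, e_j)`. -/
def ricci (g : PseudoRiemannianMetric E M) (x : M) (y z : TangentSpace 𝓘(ℝ, E) x) : ℝ :=
  metricTrace g x fun u w ↦ g.val x (curvature g x u y z) w

/-- The scalar curvature `τ = g^{ij} ρ(e_i, e_j)`. -/
def scalarCurvature (g : PseudoRiemannianMetric E M) (x : M) : ℝ :=
  metricTrace g x (ricci g x)

/-- The exterior derivative of a 1-form, `dω(X, Y) = X(ω(Y)) - Y(ω(X)) - ω([X, Y])`, computed with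
extensions of the tangent vectors that are smooth near `x`. -/
def extDerivOneForm (om : Π x : M, TangentSpace 𝓘(ℝ, E) x →L[ℝ] ℝ) (x : M)
    (u v : TangentSpace 𝓘(ℝ, E) x) : ℝ :=
  d% (fun p ↦ om p (extend E v p)) x u - d% (fun p ↦ om p (extend E u p)) x v
    - om x (mlieBracket 𝓘(ℝ, E) (extend E u) (extend E v) x)

end Tensors

/-! ### Almost hypercomplex manifolds with Hermitian and Norden metrics -/

section Quaternionic

variable (E : Type*) [NormedAddCommGroup E] [NormedSpace ℝ E]
  (M : Type*) [TopologicalSpace M] [ChartedSpace E M] [IsManifold 𝓘(ℝ, E) ∞ M]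

/-- An almost hypercomplex structure `(J_1, J_2, J_3)` on `M` together with a pseudo-Riemannian
metric for which `J_1` is an isometry and `J_2`, `J_3` are anti-isometries (so that the metric is
neutral). The indices `1, 2, 3` are `0, 1, 2 : Fin 3`, so that `(α, α + 1, α + 2)` runs through the
cyclic permutations. -/
structure NHStructure where
  g : PseudoRiemannianMetric E M
  J : Fin 3 → Π x : M, TangentSpace 𝓘(ℝ, E) x →L[ℝ] TangentSpace 𝓘(ℝ, E) x
  smooth_J (α : Fin 3) : SmoothEnd (J α)
  J_eq_comp (α : Fin 3) (x : M) : J α x = (J (α + 1) x).comp (J (α + 2) x)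
  J_eq_neg_comp (α : Fin 3) (x : M) : J α x = -(J (α + 2) x).comp (J (α + 1) x)
  J_sq (α : Fin 3) (x : M) : (J α x).comp (J α x) = -ContinuousLinearMap.id ℝ _
  hermitian (x : M) (v w : TangentSpace 𝓘(ℝ, E) x) :
    g.val x v w = g.val x (J 0 x v) (J 0 x w)
  norden (α : Fin 3) (hα : α = 1 ∨ α = 2) (x : M) (v w : TangentSpace 𝓘(ℝ, E) x) :
    g.val x v w = -g.val x (J α x v) (J α x w)

variable {E M} [FiniteDimensional ℝ E]

/-- The structure is quaternionic Kähler: the rank three bundle `Q` of endomorphisms spanned by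
`J_1, J_2, J_3` is parallel for the Levi-Civita connection, that is, the covariant derivatives of
the sections `J_α` of the frame of `Q` have values in `Q` (hence, by the Leibniz rule, so have those
of all sections of `Q`). -/
def NHStructure.IsQuaternionicKahler (S : NHStructure E M) : Prop :=
  ∀ (α : Fin 3) (x : M) (v : TangentSpace 𝓘(ℝ, E) x), ∃ a : Fin 3 → ℝ,
    ∀ y, covDerivEnd S.g (S.J α) x v y = ∑ β, a β • S.J β x y

/-- The smooth 1-forms `ω_1, ω_2, ω_3` on the open set `U` are associated to `(J_1, J_2, J_3)`:
`(∇_v J_α) y = ω_γ(v) J_β y - ω_β(v) J_γ y` for all cyclic permutations `(α, β, γ)`.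
The values of the forms outside `U` are irrelevant. -/
structure NHStructure.IsAssociatedForms (S : NHStructure E M) (U : Set M)
    (om : Fin 3 → Π x : M, TangentSpace 𝓘(ℝ, E) x →L[ℝ] ℝ) : Prop where
  smooth (α : Fin 3) : SmoothOneFormOn (om α) U
  nabla_J (α : Fin 3) (x : M) (hx : x ∈ U) (v y : TangentSpace 𝓘(ℝ, E) x) :
    covDerivEnd S.g (S.J α) x v y
      = om (α + 2) x v • S.J (α + 1) x y - om (α + 1) x v • S.J (α + 2) x y

end Quaternionic
end NHManifold
end

/-!
The metric forces a strong simplification. Write `I`, `J`, `K` for the endomorphism fields with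
indices `0`, `1`, `2`. The field `I` is skew-adjoint for `g`, whereas `J` and `K` are self-adjoint,
and `∇` preserves both types. Comparing types in `∇I = ω₂ J - ω₁ K` gives `∇I = 0` and
`ω₁ = ω₂ = 0` (`IsAssociatedForms.eq_zero`), so only `ω = ω₀` survives, with `∇J = ω K` and
`∇K = -ω J`. Uniqueness is then immediate, two of the three formulas for the derivatives read
`0 = 0`, and in the quaternionic Kähler case the same comparison of types, together with
`I ^ 2 = J ^ 2 = -1`, shows that `∇J` is a multiple of `K`; the factor is a smooth 1-form, since it
is a quotient of inner products of local vector fields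
(`IsQuaternionicKahler.exists_isAssociatedForms`).

What remains is `dω = -τ / (4 n ^ 2) g(I ·, ·)`. Differentiating twice, `R(u, v)` commutes with `I`,
and `[R(u, v), J] = Ω(u, v) K` with `Ω = dω` (`curvature_commutator`). The rest is algebra in one
tangent space. Computing the trace of `I ∘ R(u, v)` once from this commutator and once from the
Bianchi identity gives `ρ(u, I v) = n Ω(u, v)` (`IsCurvatureLike.ric_eq`). Contracting the
commutator and antisymmetrizing gives `(n - 1) (Ω(K z, y) - Ω(K y, z)) = 0`, where `n ≥ 2` enters.
With this symmetry, commuting `J` past both pairs of arguments of `g(R(x, y)z, w)` and using the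
pair symmetry yields `Ω(J x, y) g(K z, w) = Ω(J z, w) g(K x, y)`, so that `Ω = c g(I ·, ·)` and
`ρ = -n c g` (`IsCurvatureLike.exists_eq_smul_metric`). Taking the trace gives `τ = -4 n ^ 2 c`.

On the analytic side this needs the Levi-Civita connection to preserve smoothness
(`contMDiffAt_leviCivita`) and the curvature to have its usual symmetries
(`isCurvatureLike_curvature`). Smoothness is used as `ContMDiffAt` of order `∞` at a point, a
condition that is stable under differentiation.
-/

noncomputable section

namespace NHManifold

/-! ### Algebraic curvature tensors -/

section Algebra

variable {V : Type*} [AddCommGroup V] [Module ℝ V]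

/-- A symmetric nondegenerate bilinear form together with a map `R u v w` having the algebraic
symmetries of a metric curvature. Linearity of `R` is not part of the definition: it follows from
the symmetries, see `IsCurvatureLike.add_left`. -/
structure IsCurvatureLike (g : V →ₗ[ℝ] V →ₗ[ℝ] ℝ) (R : V → V → V → V) : Prop where
  symm (v w : V) : g v w = g w v
  eq_zero (v : V) : (∀ w, g v w = 0) → v = 0
  swap (u v w : V) : R u v w = -R v u w
  skew (u v w z : V) : g (R u v w) z = -g (R u v z) w
  bianchi (u v w : V) : R u v w + R v w u + R w u v = 0

variable {g : V →ₗ[ℝ] V →ₗ[ℝ] ℝ} {R : V → V → V → V}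

namespace IsCurvatureLike

theorem ext_metric (h : IsCurvatureLike g R) {v w : V} (hvw : ∀ z, g v z = g w z) : v = w :=
  sub_eq_zero.1 (h.eq_zero _ fun z ↦ by simp [hvw z])

/-- Pair symmetry, a combination of the four Bianchi identities for three of the four arguments. -/
theorem pair_symm (h : IsCurvatureLike g R) (u v w z : V) : g (R u v w) z = g (R w z u) v := by
  have s (a b c d : V) : g (R a b c) d = -g (R b a c) d := by
    conv_lhs => rw [h.swap a b c]
    simp
  have b (a b c d : V) : g (R a b c) d + g (R b c a) d + g (R c a b) d = 0 := by
    have := congrArg (fun x ↦ g x d) (h.bianchi a b c)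
    simpa using this
  have k := h.skew
  linarith [b u v w z, b v w z u, b w z u v, b z u v w, k u v z w, k u w v z, k v w u z,
    k v z w u, k w z v u, k z u w v, s u w v z, s v z w u]

theorem add_right (h : IsCurvatureLike g R) (u v w w' : V) :
    R u v (w + w') = R u v w + R u v w' :=
  h.ext_metric fun z ↦ by
    rw [h.skew, map_add, map_add, LinearMap.add_apply, h.skew u v w, h.skew u v w']; ring

theorem smul_right (h : IsCurvatureLike g R) (u v : V) (c : ℝ) (w : V) :
    R u v (c • w) = c • R u v w :=
  h.ext_metric fun z ↦ by
    rw [h.skew, map_smul, map_smul, LinearMap.smul_apply, h.skew u v w]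
    simp

theorem add_left (h : IsCurvatureLike g R) (u u' v w : V) :
    R (u + u') v w = R u v w + R u' v w :=
  h.ext_metric fun z ↦ by
    rw [h.pair_symm, h.add_right, map_add, map_add, LinearMap.add_apply, LinearMap.add_apply,
      h.pair_symm u, h.pair_symm u']

theorem smul_left (h : IsCurvatureLike g R) (c : ℝ) (u v w : V) :
    R (c • u) v w = c • R u v w :=
  h.ext_metric fun z ↦ by
    rw [h.pair_symm, h.smul_right, map_smul, map_smul, LinearMap.smul_apply, LinearMap.smul_apply,
      h.pair_symm u]

/-- The endomorphism `w ↦ R(u, v)w`. -/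
def op (h : IsCurvatureLike g R) (u v : V) : V →ₗ[ℝ] V where
  toFun := R u v
  map_add' := h.add_right u v
  map_smul' := h.smul_right u v

/-- The endomorphism `u ↦ R(u, y)z`, whose trace is the Ricci tensor. -/
def jacobiOp (h : IsCurvatureLike g R) (y z : V) : V →ₗ[ℝ] V where
  toFun u := R u y z
  map_add' u u' := h.add_left u u' y z
  map_smul' c u := h.smul_left c u y z

@[simp] theorem op_apply (h : IsCurvatureLike g R) (u v w : V) : h.op u v w = R u v w := rfl

@[simp] theorem jacobiOp_apply (h : IsCurvatureLike g R) (u y z : V) :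
    h.jacobiOp y z u = R u y z := rfl

/-- The Ricci tensor `ρ(y, z)`, the trace of `u ↦ R(u, y)z`. -/
def ric (h : IsCurvatureLike g R) (y z : V) : ℝ := LinearMap.trace ℝ V (h.jacobiOp y z)

end IsCurvatureLike

variable [FiniteDimensional ℝ V]

/-- Endomorphisms that are adjoint with respect to a nondegenerate form have the same trace. -/
theorem trace_eq_of_adjoint (hg : ∀ v, (∀ w, g v w = 0) → v = 0) {F G : V →ₗ[ℝ] V}
    (hFG : ∀ u w, g (G w) u = g w (F u)) :
    LinearMap.trace ℝ V F = LinearMap.trace ℝ V G := by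
  let e : V ≃ₗ[ℝ] Module.Dual ℝ V := LinearMap.linearEquivOfInjective g
    (by
      rw [← LinearMap.ker_eq_bot, LinearMap.ker_eq_bot']
      exact fun v hv ↦ hg v fun w ↦ congr($hv w))
    Subspace.dual_finrank_eq.symm
  have hG : e.conj G = Module.Dual.transpose F := by
    ext φ u
    obtain ⟨w, rfl⟩ := e.surjective φ
    rw [LinearEquiv.conj_apply_apply, e.symm_apply_apply]
    exact hFG u w
  rw [← LinearMap.trace_transpose', ← hG, LinearMap.trace_conj']

namespace IsCurvatureLike

/-- For self-adjoint `S` the maps `S ∘ R(·, z)y` and `R(S ·, y)z` are adjoint, by pair symmetry. -/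
theorem trace_comp_jacobiOp_symm (h : IsCurvatureLike g R) {S : V →ₗ[ℝ] V}
    (hS : ∀ v w, g (S v) w = g v (S w)) (y z : V) :
    LinearMap.trace ℝ V (S * h.jacobiOp y z) = LinearMap.trace ℝ V (S * h.jacobiOp z y) := by
  rw [LinearMap.trace_mul_comm ℝ S (h.jacobiOp y z)]
  refine (trace_eq_of_adjoint h.eq_zero fun u w ↦ ?_)
  simp only [Module.End.mul_apply, jacobiOp_apply]
  rw [hS, h.pair_symm, h.symm w, h.skew (S u) y z w, h.swap y (S u), map_neg, LinearMap.neg_apply]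

theorem ric_symm (h : IsCurvatureLike g R) (y z : V) : h.ric y z = h.ric z y := by
  simpa using! h.trace_comp_jacobiOp_symm (S := 1) (fun _ _ ↦ rfl) y z

/-- Let `I`, `J`, `K` be a quaternionic triple for which `I` is skew and `J`, `K` are self-adjoint.
If `R(u, v)` commutes with `I` and `[R(u, v), J] = Ω(u, v) K`, then the Ricci tensor is
`I`-invariant and a multiple of `Ω(·, I ·)`. -/
theorem ric_eq (h : IsCurvatureLike g R) {n : ℕ} (hdim : Module.finrank ℝ V = 4 * n)
    {I J K : V →ₗ[ℝ] V} {Ω : V → V → ℝ}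
    (hII : ∀ v, I (I v) = -v) (hKK : ∀ v, K (K v) = -v)
    (hJK : ∀ v, J (K v) = I v) (hKJ : ∀ v, K (J v) = -I v)
    (hI : ∀ u v w, R u v (I w) = I (R u v w))
    (hJ : ∀ u v w, R u v (J w) - J (R u v w) = Ω u v • K w)
    (hgI : ∀ v w, g (I v) w = -g v (I w)) (x y : V) :
    h.ric x (I y) = n * Ω x y ∧ h.ric (I x) (I y) = h.ric x y := by
  have hIl (u v w : V) : R u (I v) w = -R (I u) v w := h.ext_metric fun z ↦ by
    rw [h.pair_symm, map_neg, LinearMap.neg_apply, h.pair_symm (I u), hI, hgI, neg_neg]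
  -- The Ricci tensor is `I`-invariant.
  have hinv (y z : V) : h.ric (I y) (I z) = h.ric y z := by
    have e : h.jacobiOp (I y) (I z) = -((I * h.jacobiOp y z) * I) := by
      ext u
      simp [hI, hIl]
    have e' : I * (I * h.jacobiOp y z) = -h.jacobiOp y z := by
      ext u
      simp [hII]
    rw [ric, ric, e, map_neg, LinearMap.trace_mul_comm, e', map_neg, neg_neg]
  refine ⟨?_, hinv x y⟩
  -- The trace of `I ∘ R(x, y)`, first from the commutator with `J`, then from the Bianchi identity.
  have t1 : 2 * LinearMap.trace ℝ V (I * h.op x y) = -(4 * n * Ω x y) := by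
    have e : K * (h.op x y * J) + I * h.op x y = -(Ω x y • LinearMap.id) := by
      ext u
      have := congrArg K (hJ x y u)
      rw [map_sub, hKJ, map_smul, hKK] at this
      simp [← sub_neg_eq_add, this]
    have e' : (h.op x y * J) * K = h.op x y * I := by
      ext u
      simp [hJK]
    have := congrArg (LinearMap.trace ℝ V) e
    rw [map_add, LinearMap.trace_mul_comm ℝ K, e', LinearMap.trace_mul_comm ℝ _ I, map_neg,
      map_smul, LinearMap.trace_id, hdim, smul_eq_mul] at this
    push_cast at this
    linarith
  have t2 : I * h.op x y = h.jacobiOp y (I x) - h.jacobiOp x (I y) := by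
    ext u
    simp only [Module.End.mul_apply, op_apply, LinearMap.sub_apply, jacobiOp_apply, hI, ← map_sub]
    congr 1
    rw [← sub_eq_zero, ← h.bianchi x y u, h.swap y u x]
    abel
  rw [t2, map_sub] at t1
  change 2 * (h.ric y (I x) - h.ric x (I y)) = _ at t1
  have : h.ric y (I x) = -h.ric x (I y) := by
    have e : h.jacobiOp (-x) (I y) = - h.jacobiOp x (I y) := by
      ext u
      have := h.smul_left (-1) x u (I y)
      simp only [neg_smul, one_smul] at this
      simp [h.swap u, this]
    rw [h.ric_symm, ← hinv, hII, ric, e, map_neg, ric]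
  linarith

/-- The algebraic core of the curvature computation: in the situation of `ric_eq` and in dimension
`4n ≥ 8` the form `Ω` is a multiple of `g(I ·, ·)`, and the Ricci tensor is the corresponding
multiple of `g`. -/
theorem exists_eq_smul_metric (h : IsCurvatureLike g R) {n : ℕ} (hn : 2 ≤ n)
    (hdim : Module.finrank ℝ V = 4 * n) {I J K : V →ₗ[ℝ] V} {Ω : V → V → ℝ}
    (hII : ∀ v, I (I v) = -v) (hJJ : ∀ v, J (J v) = -v) (hKK : ∀ v, K (K v) = -v)
    (hJK : ∀ v, J (K v) = I v) (hKJ : ∀ v, K (J v) = -I v)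
    (hIJ : ∀ v, I (J v) = K v) (hIK : ∀ v, I (K v) = -J v) (hKI : ∀ v, K (I v) = J v)
    (hI : ∀ u v w, R u v (I w) = I (R u v w))
    (hJ : ∀ u v w, R u v (J w) - J (R u v w) = Ω u v • K w)
    (hgI : ∀ v w, g (I v) w = -g v (I w)) (hgJ : ∀ v w, g (J v) w = g v (J w)) :
    ∃ c : ℝ, (∀ x y, Ω x y = c * g (I x) y) ∧ ∀ x y, h.ric x y = -(n * c) * g x y := by
  have hn0 : (2 : ℝ) ≤ n := by exact_mod_cast hn
  obtain ⟨z, hz⟩ : ∃ z : V, z ≠ 0 := by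
    have : Nontrivial V := Module.nontrivial_of_finrank_pos (R := ℝ) (by omega)
    exact exists_ne 0
  have hKz : K z ≠ 0 := fun h0 ↦ hz (by simpa [h0] using hKK z)
  obtain ⟨Ω, rfl⟩ : ∃ Ω' : V → V →ₗ[ℝ] ℝ, Ω = fun u v ↦ Ω' u v :=
    ⟨fun u ↦
      { toFun := Ω u
        map_add' v v' := smul_left_injective ℝ hKz <| by
          simp only [add_smul, ← hJ, h.swap u, h.add_left, map_neg, map_add]
          abel
        map_smul' a v := smul_left_injective ℝ hKz <| by
          simp only [smul_eq_mul, mul_smul, ← hJ, h.swap u, h.smul_left, map_neg, map_smul,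
            RingHom.id_apply]
          module }, rfl⟩
  have hr (x y : V) := h.ric_eq hdim (Ω := fun u v ↦ Ω u v) hII hKK hJK hKJ hI hJ hgI x y
  have hII' (v : V) : I (-I v) = v := by rw [map_neg, hII, neg_neg]
  have hΩI (x y : V) : Ω (I x) (I y) = Ω x y := by
    have h1 := (hr (I x) (I y)).1
    rw [(hr x (I y)).2, (hr x y).1] at h1
    exact (mul_left_cancel₀ (by positivity) h1).symm
  have hΩs (x y : V) : Ω x y = -Ω y x := by
    refine smul_left_injective ℝ hKz ?_
    simp only [neg_smul, ← hJ, h.swap x y, map_neg]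
    abel
  have hric (y w : V) : h.ric y w = -(n * Ω y (I w)) := by
    have := (hr y (-I w)).1
    rwa [hII', map_neg, mul_neg] at this
  -- Contracting the commutator identity for `J` and antisymmetrizing the result.
  have hK (y z : V) : Ω (K z) y = Ω (K y) z := by
    have key (y z : V) : h.ric y (J z) - LinearMap.trace ℝ V (J * h.jacobiOp y z) = Ω (K z) y := by
      have e : h.jacobiOp y (J z) - J * h.jacobiOp y z = -(Ω y).smulRight (K z) := by
        ext u
        simp [hJ, hΩs u y]
      have := congrArg (LinearMap.trace ℝ V) e
      rw [map_sub, map_neg, LinearMap.trace_smulRight, ← hΩs] at this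
      exact this
    have h1 := key y z
    have h2 := key z y
    rw [h.trace_comp_jacobiOp_symm hgJ] at h1
    rw [hric, hIJ, hΩs] at h1 h2
    have : ((n : ℝ) - 1) * (Ω (K z) y - Ω (K y) z) = 0 := by linarith
    rcases mul_eq_zero.1 this with h3 | h3 <;> linarith
  have hJΩ (x y : V) : Ω x (J y) = -Ω (J x) y := by
    rw [← hKI x, hK, ← hΩI (K y), hIK, hII, map_neg, neg_neg, hΩs (-J y), map_neg, neg_neg]
  -- The commutator with `J`, inserted into both pairs of arguments of `g(R(x, y)z, w)`.
  have hfour (x y z w : V) : Ω (J x) y * g (K z) w = Ω (J z) w * g (K x) y := by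
    have c (x y z w : V) : g (R x y (J z)) w - g (R x y z) (J w) = Ω x y * g (K z) w := by
      rw [← hgJ, ← LinearMap.sub_apply, ← map_sub, hJ, map_smul, LinearMap.smul_apply, smul_eq_mul]
    have c1 := c (J x) y z w
    have c2 := c x (J y) z w
    have c3 := c (J z) w x y
    have c4 := c z (J w) x y
    rw [hJΩ] at c2 c4
    rw [h.pair_symm _ _ (J _), h.pair_symm _ _ x] at c3 c4
    linarith
  obtain ⟨w, hw⟩ : ∃ w, g (K z) w ≠ 0 := by
    by_contra! hc
    exact hKz (h.eq_zero _ hc)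
  have hΩ (x y : V) : Ω x y = Ω (J z) w / g (K z) w * g (I x) y := by
    have := hfour (-J x) y z w
    rw [map_neg, hJJ, neg_neg, map_neg, hKJ, neg_neg] at this
    field_simp
    exact this
  refine ⟨Ω (J z) w / g (K z) w, hΩ, fun x y ↦ ?_⟩
  rw [hric, hΩ, hgI, hII, map_neg]
  ring

end IsCurvatureLike

end Algebra

/-! ### Smoothness of the Levi-Civita connection -/

section Smoothness

variable {E : Type*} [NormedAddCommGroup E] [NormedSpace ℝ E]
  {M : Type*} [TopologicalSpace M] [ChartedSpace E M] [IsManifold 𝓘(ℝ, E) ∞ M]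

theorem mdiffAt_of_contMDiffAt {X : Π x : M, TangentSpace 𝓘(ℝ, E) x} {x : M}
    (hX : CMDiffAt ∞ (T% X) x) : MDiffAt (T% X) x :=
  hX.mdifferentiableAt (by simp)

theorem eventually_mdifferentiableAt {X : Π x : M, TangentSpace 𝓘(ℝ, E) x} {x : M}
    (hX : CMDiffAt ∞ (T% X) x) : ∀ᶠ p in 𝓝 x, MDiffAt (T% X) p := by
  have h1 : CMDiffAt 1 (T% X) x := hX.of_le (by simp)
  filter_upwards [(contMDiffAt_iff_contMDiffAt_nhds (by simp)).1 h1] with p hp using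
    hp.mdifferentiableAt (by simp)

theorem contMDiffAt_metric (g : PseudoRiemannianMetric E M)
    {X Y : Π x : M, TangentSpace 𝓘(ℝ, E) x} {x : M}
    (hX : CMDiffAt ∞ (T% X) x) (hY : CMDiffAt ∞ (T% Y) x) :
    CMDiffAt ∞ (fun p ↦ g.val p (X p) (Y p)) x := by
  have : ContMDiffAt 𝓘(ℝ, E) (𝓘(ℝ, E).prod 𝓘(ℝ)) ∞
      (fun m ↦ TotalSpace.mk' ℝ (E := Bundle.Trivial M ℝ) m (g.val m (X m) (Y m))) x := by
    apply ContMDiffAt.clm_bundle_apply₂ (F₁ := E) (F₂ := E)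
    · exact g.contMDiff x
    · exact hX
    · exact hY
  simp only [contMDiffAt_totalSpace] at this
  exact this.2

theorem contMDiffAt_mvfderiv_apply {f : M → ℝ} {X : Π x : M, TangentSpace 𝓘(ℝ, E) x} {x : M}
    (hf : CMDiffAt ∞ f x) (hX : CMDiffAt ∞ (T% X) x) :
    CMDiffAt ∞ (fun p ↦ d% f p (X p)) x := by
  have : IsManifold 𝓘(ℝ, E) 1 M := .of_le (n := ∞) (by simp)
  have h1 := hf.mfderiv_const (m := ∞) (by simp)
  have h2 : ContMDiffAt 𝓘(ℝ, E) (𝓘(ℝ).prod 𝓘(ℝ)) ∞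
    (fun p ↦ (⟨f p, mfderiv% f p (X p)⟩ : TangentBundle 𝓘(ℝ) ℝ)) x :=
    ContMDiffAt.clm_apply_of_inCoordinates (b₁ := fun p : M ↦ p) (b₂ := f) h1 hX hf
  rw [contMDiffAt_totalSpace] at h2
  simpa using! h2.2

theorem contMDiffAt_mlieBracket [FiniteDimensional ℝ E] {X Y : Π x : M, TangentSpace 𝓘(ℝ, E) x}
    {x : M} (hX : CMDiffAt ∞ (T% X) x) (hY : CMDiffAt ∞ (T% Y) x) :
    CMDiffAt ∞ (T% (mlieBracket 𝓘(ℝ, E) X Y)) x := by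
  have : IsManifold 𝓘(ℝ, E) (minSmoothness ℝ 2) M :=
    .of_le (n := ∞) (by simpa using ENat.LEInfty.out)
  have : IsManifold 𝓘(ℝ, E) (((⊤ : ℕ∞) : WithTop ℕ∞) + 1) M := by simpa
  exact ContMDiffAt.mlieBracket_vectorField (m := ⊤) (n := ⊤) hX hY (by simp)

theorem contMDiffAt_koszul [FiniteDimensional ℝ E] (g : PseudoRiemannianMetric E M)
    {X Y Z : Π x : M, TangentSpace 𝓘(ℝ, E) x} {x : M} (hX : CMDiffAt ∞ (T% X) x)
    (hY : CMDiffAt ∞ (T% Y) x) (hZ : CMDiffAt ∞ (T% Z) x) :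
    CMDiffAt ∞ (koszul g X Y Z) x := by
  have h1 := contMDiffAt_mvfderiv_apply (contMDiffAt_metric g hY hZ) hX
  have h2 := contMDiffAt_mvfderiv_apply (contMDiffAt_metric g hZ hX) hY
  have h3 := contMDiffAt_mvfderiv_apply (contMDiffAt_metric g hX hY) hZ
  have h4 := contMDiffAt_metric g (contMDiffAt_mlieBracket hX hY) hZ
  have h5 := contMDiffAt_metric g (contMDiffAt_mlieBracket hY hZ) hX
  have h6 := contMDiffAt_metric g (contMDiffAt_mlieBracket hZ hX) hY
  exact ((((h1.add h2).sub h3).add h4).sub h5).add h6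

theorem contMDiffAt_extend_tangent {x : M} (v : TangentSpace 𝓘(ℝ, E) x) :
    CMDiffAt ∞ (T% (extend E v)) x :=
  contMDiffAt_extend 𝓘(ℝ, E) E v

theorem eventually_contMDiffAt_extend {x : M} (v : TangentSpace 𝓘(ℝ, E) x) :
    ∀ᶠ p in 𝓝 x, CMDiffAt ∞ (T% (extend E v)) p := by
  obtain ⟨s, hs, h⟩ := exists_contMDiffOn_extend (k := ∞) 𝓘(ℝ, E) E v
  filter_upwards [eventually_mem_nhds_iff.2 hs] with p hp using h.contMDiffAt hp

/-- `[X, Y] f = X (Y f) - Y (X f)`, by comparing the Jacobi identities for `X, Y, f Z` and for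
`X, Y, Z`, where `Z` does not vanish at the point. -/
theorem mvfderiv_mlieBracket [FiniteDimensional ℝ E] {f : M → ℝ}
    {X Y : Π x : M, TangentSpace 𝓘(ℝ, E) x} {x : M} (hf : CMDiffAt ∞ f x)
    (hX : CMDiffAt ∞ (T% X) x) (hY : CMDiffAt ∞ (T% Y) x) :
    d% f x (mlieBracket 𝓘(ℝ, E) X Y x)
      = d% (fun p ↦ d% f p (Y p)) x (X x) - d% (fun p ↦ d% f p (X p)) x (Y x) := by
  rcases subsingleton_or_nontrivial E with hE | hE
  · have (v : TangentSpace 𝓘(ℝ, E) x) : v = 0 := Subsingleton.elim (α := E) _ _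
    rw [this (mlieBracket 𝓘(ℝ, E) X Y x), this (X x), this (Y x)]
    simp
  obtain ⟨z, hz⟩ : ∃ z : TangentSpace 𝓘(ℝ, E) x, z ≠ 0 := exists_ne (α := E) 0
  let Z := extend E z
  have hZ : CMDiffAt ∞ (T% Z) x := contMDiffAt_extend_tangent z
  have hZx : Z x = z := extend_apply_self ..
  have : IsManifold 𝓘(ℝ, E) (minSmoothness ℝ 3) M :=
    .of_le (n := ∞) (by simpa using ENat.LEInfty.out)
  have h2 {W : Π x : M, TangentSpace 𝓘(ℝ, E) x} (hW : CMDiffAt ∞ (T% W) x) :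
      CMDiffAt (minSmoothness ℝ 2) (T% W) x := hW.of_le (by simpa using ENat.LEInfty.out)
  have hfZ : CMDiffAt ∞ (T% (f • Z)) x := hf.smul_section hZ
  have j1 := leibniz_identity_mlieBracket_apply (h2 hX) (h2 hY) (h2 hfZ)
  have j2 := leibniz_identity_mlieBracket_apply (h2 hX) (h2 hY) (h2 hZ)
  have hfe : ∀ᶠ p in 𝓝 x, MDiffAt f p := by
    have h1 : CMDiffAt 1 f x := hf.of_le (by simp)
    filter_upwards [(contMDiffAt_iff_contMDiffAt_nhds (by simp)).1 h1] with p hp using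
      hp.mdifferentiableAt (by simp)
  have md {W : Π x : M, TangentSpace 𝓘(ℝ, E) x} (hW : CMDiffAt ∞ (T% W) x) :
      MDiffAt (T% W) x := hW.mdifferentiableAt (by simp)
  have br (W : Π x : M, TangentSpace 𝓘(ℝ, E) x) : mlieBracket 𝓘(ℝ, E) W (f • Z)
      =ᶠ[𝓝 x] (fun p ↦ d% f p (W p)) • Z + f • mlieBracket 𝓘(ℝ, E) W Z := by
    filter_upwards [hfe, eventually_mdifferentiableAt hZ] with p h1 h2
    simpa using! mlieBracket_smul_right h1 h2
  have two {W W' : Π x : M, TangentSpace 𝓘(ℝ, E) x} (hW : CMDiffAt ∞ (T% W) x)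
      (hW' : CMDiffAt ∞ (T% W') x) :
      mlieBracket 𝓘(ℝ, E) W (mlieBracket 𝓘(ℝ, E) W' (f • Z)) x
        = d% (fun p ↦ d% f p (W' p)) x (W x) • Z x
          + d% f x (W' x) • mlieBracket 𝓘(ℝ, E) W Z x
          + d% f x (W x) • mlieBracket 𝓘(ℝ, E) W' Z x
          + f x • mlieBracket 𝓘(ℝ, E) W (mlieBracket 𝓘(ℝ, E) W' Z) x := by
    have a := contMDiffAt_mvfderiv_apply hf hW'
    have b := contMDiffAt_mlieBracket hW' hZ
    rw [Filter.EventuallyEq.mlieBracket_vectorField_eq (Filter.EventuallyEq.refl _ W) (br W'),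
      mlieBracket_add_right (md (a.smul_section hZ)) (md (hf.smul_section b)),
      mlieBracket_smul_right (a.mdifferentiableAt (by simp)) (md hZ),
      mlieBracket_smul_right (hf.mdifferentiableAt (by simp)) (md b)]
    abel
  rw [two hX hY, two hY hX, (br _).self_of_nhds] at j1
  simp only [Pi.add_apply, Pi.smul_apply', j2, smul_add] at j1
  have : (d% (fun p ↦ d% f p (Y p)) x (X x) - d% (fun p ↦ d% f p (X p)) x (Y x)
      - d% f x (mlieBracket 𝓘(ℝ, E) X Y x)) • Z x = 0 := by
    rw [sub_smul, sub_smul]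
    rw [← sub_eq_zero.2 j1]
    abel
  rw [hZx, smul_eq_zero] at this
  linarith [this.resolve_right hz]

variable [FiniteDimensional ℝ E]

/-- A vector field is smooth if its inner products with smooth vector fields are smooth. In a local
frame its coordinates are obtained from such inner products by inverting the metric. -/
theorem contMDiffAt_of_metric (g : PseudoRiemannianMetric E M)
    {V : Π x : M, TangentSpace 𝓘(ℝ, E) x} {x : M}
    (hV : ∀ W : Π x : M, TangentSpace 𝓘(ℝ, E) x, CMDiffAt ∞ (T% W) x →
      CMDiffAt ∞ (fun p ↦ g.val p (V p) (W p)) x) :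
    CMDiffAt ∞ (T% V) x := by
  let e := trivializationAt E (TangentSpace 𝓘(ℝ, E) : M → Type _) x
  have hx : x ∈ e.baseSet := mem_baseSet_trivializationAt E _ x
  let b := Module.finBasis ℝ E
  let s := e.localFrame b
  have hs (i) : CMDiffAt ∞ (T% (s i)) x := contMDiffAt_localFrame_of_mem ∞ e b i hx
  let c (i) : E →L[ℝ] ℝ := LinearMap.toContinuousLinearMap (b.coord i)
  -- The metric and the form `g(V, ·)` in the coordinates given by the frame.
  let G (p : M) : E →L[ℝ] E →L[ℝ] ℝ :=
    ∑ i, ∑ j, g.val p (s i p) (s j p) • (c i).smulRight (c j)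
  let φ (p : M) : E →L[ℝ] ℝ := ∑ j, g.val p (V p) (s j p) • c j
  have hG : CMDiffAt ∞ G x := ContMDiffAt.sum fun i _ ↦ ContMDiffAt.sum fun j _ ↦
    (contMDiffAt_metric g (hs i) (hs j)).smul contMDiffAt_const
  have hφ : CMDiffAt ∞ φ x := ContMDiffAt.sum fun j _ ↦ (hV _ (hs j)).smul contMDiffAt_const
  have expand {p : M} (hp : p ∈ e.baseSet) (w : E) : ∑ i, c i w • s i p = e.symmL ℝ p w := by
    have hi (i) : s i p = e.symmL ℝ p (b i) := by simp [s, hp, Bundle.Trivialization.basisAt]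
    simp only [hi, ← map_smul, ← map_sum]
    exact congrArg _ (b.sum_repr w)
  have hGval {p : M} (hp : p ∈ e.baseSet) (v w : E) :
      G p v w = g.val p (e.symmL ℝ p v) (e.symmL ℝ p w) := by
    rw [← expand hp, ← expand hp]
    simp only [G, _root_.sum_apply, map_sum, map_smul, _root_.smul_apply,
      ContinuousLinearMap.smulRight_apply, smul_eq_mul, Finset.mul_sum]
    rw [Finset.sum_comm]
    refine Finset.sum_congr rfl fun i _ ↦ Finset.sum_congr rfl fun j _ ↦ ?_
    ring
  have hφval {p : M} (hp : p ∈ e.baseSet) (w : E) :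
      φ p w = g.val p (V p) (e.symmL ℝ p w) := by
    rw [← expand hp]
    simp [φ, mul_comm]
  have hG_equiv {p : M} (hp : p ∈ e.baseSet) : ∃ L : E ≃L[ℝ] (E →L[ℝ] ℝ), ↑L = G p := by
    have hinj : Function.Injective (G p).toLinearMap := by
      rw [← LinearMap.ker_eq_bot, LinearMap.ker_eq_bot']
      intro v hv
      have h0 : e.symmL ℝ p v = 0 := g.nondegenerate p _ fun w ↦ by
        rw [← e.symmL_continuousLinearMapAt (R := ℝ) hp w, ← hGval hp]
        exact congr($hv _)
      rw [← e.continuousLinearMapAt_symmL (R := ℝ) hp v, h0, map_zero]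
    have hrank : Module.finrank ℝ E = Module.finrank ℝ (E →L[ℝ] ℝ) := by
      rw [← Subspace.dual_finrank_eq (K := ℝ)]
      exact (LinearMap.toContinuousLinearMap (𝕜 := ℝ) (E := E) (F' := ℝ)).finrank_eq
    exact ⟨(LinearMap.linearEquivOfInjective _ hinj hrank).toContinuousLinearEquiv, by ext; rfl⟩
  obtain ⟨L, hL⟩ := hG_equiv hx
  have hinv : CMDiffAt ∞ (fun p ↦ (G p).inverse (φ p)) x := by
    have h1 : ContDiffAt ℝ ∞ ContinuousLinearMap.inverse (G x) :=
      hL ▸ contDiffAt_map_inverse L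
    exact (h1.contMDiffAt.comp x hG).clm_apply hφ
  rw [e.contMDiffAt_section_iff hx]
  refine hinv.congr_of_eventuallyEq ?_
  filter_upwards [e.open_baseSet.mem_nhds hx] with p hp
  obtain ⟨L', hL'⟩ := hG_equiv hp
  rw [← hL', ContinuousLinearMap.inverse_equiv, ContinuousLinearEquiv.coe_coe,
    ContinuousLinearEquiv.eq_symm_apply]
  ext w
  have h1 : L' (e ⟨p, V p⟩).2 w = G p (e ⟨p, V p⟩).2 w := congr($hL' _ w)
  have h2 : (e ⟨p, V p⟩).2 = e.continuousLinearMapAt ℝ p (V p) := by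
    simp [hp]
  rw [h1, hGval hp, hφval hp, h2, e.symmL_continuousLinearMapAt hp]

/-- `∇_X Y` is smooth if `X` and `Y` are. -/
theorem contMDiffAt_leviCivita (g : PseudoRiemannianMetric E M)
    {X Y : Π x : M, TangentSpace 𝓘(ℝ, E) x} {x : M}
    (hX : CMDiffAt ∞ (T% X) x) (hY : CMDiffAt ∞ (T% Y) x) :
    CMDiffAt ∞ (T% (fun p ↦ leviCivita g Y p (X p))) x := by
  refine contMDiffAt_of_metric g fun W hW ↦ ?_
  have h := (contMDiffAt_const (c := (1 / 2 : ℝ))).mul (contMDiffAt_koszul g hX hY hW)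
  refine h.congr_of_eventuallyEq ?_
  filter_upwards [eventually_mdifferentiableAt hX, eventually_mdifferentiableAt hY,
    eventually_mdifferentiableAt hW] with p h1 h2 h3
  change g.val p (leviCivitaFun g Y p (X p)) (W p) = 1 / 2 * koszul g X Y W p
  rw [← val_leviCivitaFun g h1 h2 h3]
  ring

end Smoothness

/-! ### Symmetries of the curvature of the Levi-Civita connection -/

section Curvature

variable {E : Type*} [NormedAddCommGroup E] [NormedSpace ℝ E] [FiniteDimensional ℝ E]
  {M : Type*} [TopologicalSpace M] [ChartedSpace E M] [IsManifold 𝓘(ℝ, E) ∞ M]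

omit [FiniteDimensional ℝ E] [IsManifold 𝓘(ℝ, E) ∞ M] in
theorem mvfderiv_congr {f f' : M → ℝ} {x : M} (h : f =ᶠ[𝓝 x] f') (v : TangentSpace 𝓘(ℝ, E) x) :
    d% f x v = d% f' x v := by
  simp only [mvfderiv, h.mfderiv_eq]
  rfl

theorem leviCivita_add (g : PseudoRiemannianMetric E M) {Y Y' : Π x : M, TangentSpace 𝓘(ℝ, E) x}
    {x : M} (hY : MDiffAt (T% Y) x) (hY' : MDiffAt (T% Y') x) (v : TangentSpace 𝓘(ℝ, E) x) :
    leviCivita g (Y + Y') x v = leviCivita g Y x v + leviCivita g Y' x v := by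
  have := (leviCivita g).isCovariantDerivativeOnUniv.add hY hY'
  rw [this, _root_.add_apply]

theorem leviCivita_smul (g : PseudoRiemannianMetric E M) {Y : Π x : M, TangentSpace 𝓘(ℝ, E) x}
    {f : M → ℝ} {x : M} (hf : MDiffAt f x) (hY : MDiffAt (T% Y) x) (v : TangentSpace 𝓘(ℝ, E) x) :
    leviCivita g (f • Y) x v = f x • leviCivita g Y x v + d% f x v • Y x := by
  have := (leviCivita g).isCovariantDerivativeOnUniv.leibniz hY hf
  rw [this, _root_.add_apply, _root_.smul_apply, ContinuousLinearMap.smulRight_apply]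

theorem leviCivita_congr (g : PseudoRiemannianMetric E M) {Y Y' : Π x : M, TangentSpace 𝓘(ℝ, E) x}
    {x : M} (hY : MDiffAt (T% Y) x) (hY' : MDiffAt (T% Y') x) (h : ∀ᶠ p in 𝓝 x, Y p = Y' p)
    (v : TangentSpace 𝓘(ℝ, E) x) : leviCivita g Y x v = leviCivita g Y' x v :=
  congr($((leviCivita g).isCovariantDerivativeOnUniv.congr_of_eventuallyEq hY hY'
    Filter.univ_mem h) v)

theorem val_curvatureField_skew (g : PseudoRiemannianMetric E M)
    {X Y Z W : Π x : M, TangentSpace 𝓘(ℝ, E) x} {x : M}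
    (hX : CMDiffAt ∞ (T% X) x) (hY : CMDiffAt ∞ (T% Y) x) (hZ : CMDiffAt ∞ (T% Z) x)
    (hW : CMDiffAt ∞ (T% W) x) :
    g.val x (curvatureField g X Y Z x) (W x) = -g.val x (curvatureField g X Y W x) (Z x) := by
  have two {X Y : Π x : M, TangentSpace 𝓘(ℝ, E) x} (hX : CMDiffAt ∞ (T% X) x)
      (hY : CMDiffAt ∞ (T% Y) x) :
      d% (fun p ↦ d% (fun q ↦ g.val q (Z q) (W q)) p (Y p)) x (X x)
        = g.val x (leviCivita g (fun p ↦ leviCivita g Z p (Y p)) x (X x)) (W x)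
          + g.val x (leviCivita g Z x (Y x)) (leviCivita g W x (X x))
          + (g.val x (leviCivita g Z x (X x)) (leviCivita g W x (Y x))
          + g.val x (Z x) (leviCivita g (fun p ↦ leviCivita g W p (Y p)) x (X x))) := by
    have hYZ := mdiffAt_of_contMDiffAt (contMDiffAt_leviCivita g hY hZ)
    have hYW := mdiffAt_of_contMDiffAt (contMDiffAt_leviCivita g hY hW)
    have hX' := mdiffAt_of_contMDiffAt hX
    have hZ' := mdiffAt_of_contMDiffAt hZ
    have hW' := mdiffAt_of_contMDiffAt hW
    have e : (fun p ↦ d% (fun q ↦ g.val q (Z q) (W q)) p (Y p)) =ᶠ[𝓝 x]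
        (fun p ↦ g.val p (leviCivita g Z p (Y p)) (W p))
          + fun p ↦ g.val p (Z p) (leviCivita g W p (Y p)) := by
      filter_upwards [eventually_mdifferentiableAt hY, eventually_mdifferentiableAt hZ,
        eventually_mdifferentiableAt hW] with p h1 h2 h3
      exact leviCivita_metric g h1 h2 h3
    rw [mvfderiv_congr e, mvfderiv_add (mdifferentiableAt_metric g hYZ hW')
      (mdifferentiableAt_metric g hZ' hYW), _root_.add_apply,
      leviCivita_metric g hX' hYZ hW', leviCivita_metric g hX' hZ' hYW]
  have h := mvfderiv_mlieBracket (contMDiffAt_metric g hZ hW) hX hY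
  rw [two hX hY, two hY hX, leviCivita_metric g
    (mdiffAt_of_contMDiffAt (contMDiffAt_mlieBracket hX hY)) (mdiffAt_of_contMDiffAt hZ)
    (mdiffAt_of_contMDiffAt hW)] at h
  simp only [curvatureField, map_sub, _root_.sub_apply]
  rw [g.symm x (Z x), g.symm x (Z x), g.symm x (Z x)] at h
  linarith

/-- The first Bianchi identity, from the vanishing of the torsion and the Jacobi identity. -/
theorem curvatureField_bianchi (g : PseudoRiemannianMetric E M)
    {X Y Z : Π x : M, TangentSpace 𝓘(ℝ, E) x} {x : M}
    (hX : CMDiffAt ∞ (T% X) x) (hY : CMDiffAt ∞ (T% Y) x) (hZ : CMDiffAt ∞ (T% Z) x) :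
    curvatureField g X Y Z x + curvatureField g Y Z X x + curvatureField g Z X Y x = 0 := by
  have tor {X Y Z : Π x : M, TangentSpace 𝓘(ℝ, E) x} (hX : CMDiffAt ∞ (T% X) x)
      (hY : CMDiffAt ∞ (T% Y) x) (hZ : CMDiffAt ∞ (T% Z) x) :
      leviCivita g (fun p ↦ leviCivita g Z p (Y p)) x (X x)
        = leviCivita g (fun p ↦ leviCivita g Y p (Z p)) x (X x)
          + leviCivita g X x (mlieBracket 𝓘(ℝ, E) Y Z x)
          + mlieBracket 𝓘(ℝ, E) X (mlieBracket 𝓘(ℝ, E) Y Z) x := by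
    have hB := mdiffAt_of_contMDiffAt (contMDiffAt_mlieBracket hY hZ)
    have hYZ := mdiffAt_of_contMDiffAt (contMDiffAt_leviCivita g hY hZ)
    have hZY := mdiffAt_of_contMDiffAt (contMDiffAt_leviCivita g hZ hY)
    rw [← leviCivita_torsion g (mdiffAt_of_contMDiffAt hX) hB,
      leviCivita_congr g (Y' := (fun p ↦ leviCivita g Y p (Z p)) + mlieBracket 𝓘(ℝ, E) Y Z) hYZ
        (mdifferentiableAt_add_section hZY hB) _ (X x), leviCivita_add g hZY hB]
    · abel
    filter_upwards [eventually_mdifferentiableAt hY, eventually_mdifferentiableAt hZ] with p h1 h2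
    rw [Pi.add_apply, ← leviCivita_torsion g h1 h2]
    abel
  have : IsManifold 𝓘(ℝ, E) (minSmoothness ℝ 3) M :=
    .of_le (n := ∞) (by simpa using ENat.LEInfty.out)
  have h2 {W : Π x : M, TangentSpace 𝓘(ℝ, E) x} (hW : CMDiffAt ∞ (T% W) x) :
      CMDiffAt (minSmoothness ℝ 2) (T% W) x := hW.of_le (by simpa using ENat.LEInfty.out)
  have j := leibniz_identity_mlieBracket_apply (h2 hX) (h2 hY) (h2 hZ)
  rw [mlieBracket_swap_apply (V := mlieBracket 𝓘(ℝ, E) X Y), mlieBracket_swap (V := X) (W := Z)]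
    at j
  have e : mlieBracket 𝓘(ℝ, E) Y (-mlieBracket 𝓘(ℝ, E) Z X) x
      = -mlieBracket 𝓘(ℝ, E) Y (mlieBracket 𝓘(ℝ, E) Z X) x := by
    have := mlieBracket_const_smul_right (V := Y) (c := (-1 : ℝ))
      (mdiffAt_of_contMDiffAt (contMDiffAt_mlieBracket hZ hX))
    simpa using this
  rw [e] at j
  simp only [curvatureField]
  rw [tor hX hY hZ, tor hY hZ hX, tor hZ hX hY, j]
  abel

/-- The metric at a point as a bilinear form. -/
def metricForm (g : PseudoRiemannianMetric E M) (x : M) :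
    TangentSpace 𝓘(ℝ, E) x →ₗ[ℝ] TangentSpace 𝓘(ℝ, E) x →ₗ[ℝ] ℝ :=
  ContinuousLinearMap.coeLM ℝ ∘ₗ (g.val x).toLinearMap

omit [FiniteDimensional ℝ E] in
@[simp] theorem metricForm_apply (g : PseudoRiemannianMetric E M) (x : M)
    (v w : TangentSpace 𝓘(ℝ, E) x) : metricForm g x v w = g.val x v w := rfl

theorem isCurvatureLike_curvature (g : PseudoRiemannianMetric E M) (x : M) :
    IsCurvatureLike (metricForm g x) (curvature g x) where
  symm := g.symm x
  eq_zero := g.nondegenerate x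
  swap u v w := by
    simp only [curvature, curvatureField]
    rw [mlieBracket_swap_apply, map_neg]
    abel
  skew u v w z := by
    have := val_curvatureField_skew g (contMDiffAt_extend_tangent u) (contMDiffAt_extend_tangent v)
      (contMDiffAt_extend_tangent w) (contMDiffAt_extend_tangent z)
    rwa [extend_apply_self, extend_apply_self] at this
  bianchi u v w := curvatureField_bianchi g (contMDiffAt_extend_tangent u)
    (contMDiffAt_extend_tangent v) (contMDiffAt_extend_tangent w)

/-- The curvature is tensorial in its last argument. As `R(X, Y)` is skew-adjoint, the value of
`g(R(X, Y)Z, W)` depends only on the value of `Z` at the point. -/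
theorem curvatureField_extend (g : PseudoRiemannianMetric E M) {x : M}
    (u v : TangentSpace 𝓘(ℝ, E) x) {Z : Π x : M, TangentSpace 𝓘(ℝ, E) x}
    (hZ : CMDiffAt ∞ (T% Z) x) :
    curvatureField g (extend E u) (extend E v) Z x = curvature g x u v (Z x) := by
  refine (isCurvatureLike_curvature g x).ext_metric fun w ↦ ?_
  have h1 := val_curvatureField_skew g (contMDiffAt_extend_tangent u)
    (contMDiffAt_extend_tangent v) hZ (contMDiffAt_extend_tangent w)
  rw [extend_apply_self] at h1
  rw [(isCurvatureLike_curvature g x).skew]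
  exact h1

theorem metricTrace_eq_trace (g : PseudoRiemannianMetric E M) (x : M)
    (F : TangentSpace 𝓘(ℝ, E) x →ₗ[ℝ] TangentSpace 𝓘(ℝ, E) x) :
    metricTrace g x (fun u w ↦ g.val x (F u) w) = LinearMap.trace ℝ _ F := by
  have : FiniteDimensional ℝ (TangentSpace 𝓘(ℝ, E) x) := inferInstanceAs (FiniteDimensional ℝ E)
  rw [LinearMap.trace_eq_matrix_trace ℝ (Module.finBasis ℝ (TangentSpace 𝓘(ℝ, E) x)), Matrix.trace]
  refine Finset.sum_congr rfl fun i _ ↦ ?_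
  change g.val x (F _) _ = _
  rw [g.symm, val_flat_symm]
  simp [LinearMap.toMatrix_apply]

theorem ricci_eq_ric (g : PseudoRiemannianMetric E M) (x : M) (y z : TangentSpace 𝓘(ℝ, E) x) :
    ricci g x y z = (isCurvatureLike_curvature g x).ric y z :=
  metricTrace_eq_trace g x ((isCurvatureLike_curvature g x).jacobiOp y z)

/-- The scalar curvature of an Einstein metric. -/
theorem scalarCurvature_eq (g : PseudoRiemannianMetric E M) (x : M) {a : ℝ}
    (h : ∀ y z, ricci g x y z = a * g.val x y z) :
    scalarCurvature g x = a * Module.finrank ℝ E := by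
  have : FiniteDimensional ℝ (TangentSpace 𝓘(ℝ, E) x) := inferInstanceAs (FiniteDimensional ℝ E)
  have e : ricci g x = fun u w ↦ g.val x ((a • LinearMap.id :
      TangentSpace 𝓘(ℝ, E) x →ₗ[ℝ] TangentSpace 𝓘(ℝ, E) x) u) w := by
    ext u w
    simp [h]
  rw [scalarCurvature, e, metricTrace_eq_trace, map_smul, LinearMap.trace_id, smul_eq_mul]
  rfl

end Curvature

/-! ### Covariant derivatives of endomorphism fields -/

section Endomorphisms

variable {E : Type*} [NormedAddCommGroup E] [NormedSpace ℝ E] [FiniteDimensional ℝ E]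
  {M : Type*} [TopologicalSpace M] [ChartedSpace E M] [IsManifold 𝓘(ℝ, E) ∞ M]
  {P Q S : Π x : M, TangentSpace 𝓘(ℝ, E) x →L[ℝ] TangentSpace 𝓘(ℝ, E) x}

omit [FiniteDimensional ℝ E] in
theorem SmoothEnd.contMDiffAt_apply (hP : SmoothEnd P) {Y : Π x : M, TangentSpace 𝓘(ℝ, E) x}
    {x : M} (hY : CMDiffAt ∞ (T% Y) x) : CMDiffAt ∞ (T% (fun p ↦ P p (Y p))) x :=
  ContMDiffAt.clm_bundle_apply (F₁ := E) (F₂ := E) (hP x) hY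

theorem leviCivita_end (g : PseudoRiemannianMetric E M) (hP : SmoothEnd P) {x : M}
    (v : TangentSpace 𝓘(ℝ, E) x) {Y : Π x : M, TangentSpace 𝓘(ℝ, E) x} (hY : MDiffAt (T% Y) x) :
    leviCivita g (fun p ↦ P p (Y p)) x v
      = covDerivEnd g P x v (Y x) + P x (leviCivita g Y x v) := by
  rw [covDerivEnd_eq g hP v hY, sub_add_cancel]

/-- The Leibniz rule for the composition of endomorphism fields. -/
theorem covDerivEnd_comp (g : PseudoRiemannianMetric E M) (hP : SmoothEnd P) (hQ : SmoothEnd Q)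
    {x : M} (v y : TangentSpace 𝓘(ℝ, E) x) :
    covDerivEnd g (fun p ↦ (P p).comp (Q p)) x v y
      = covDerivEnd g P x v (Q x y) + P x (covDerivEnd g Q x v y) := by
  have hY := contMDiffAt_extend_tangent y
  have h := leviCivita_end g hP v (mdiffAt_of_contMDiffAt (hQ.contMDiffAt_apply hY))
  rw [extend_apply_self] at h
  simp only [covDerivEnd, ContinuousLinearMap.comp_apply] at h ⊢
  rw [h, map_sub]
  abel

theorem covDerivEnd_neg_id (g : PseudoRiemannianMetric E M) {x : M}
    (v y : TangentSpace 𝓘(ℝ, E) x) :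
    covDerivEnd g (fun _ ↦ -ContinuousLinearMap.id ℝ _) x v y = 0 := by
  have h := (leviCivita g).isCovariantDerivativeOnUniv.smul_const (-1 : ℝ)
    (mdiffAt_of_contMDiffAt (contMDiffAt_extend_tangent y))
  have e : (fun p ↦ (-ContinuousLinearMap.id ℝ (TangentSpace 𝓘(ℝ, E) p)) (extend E y p))
      = (-1 : ℝ) • extend E y := by
    ext p
    simp
  rw [covDerivEnd, e, h]
  simp

/-- The covariant derivative of a field of self-adjoint (`c = 1`) or skew-adjoint (`c = -1`)
endomorphisms is of the same type. -/
theorem val_covDerivEnd (g : PseudoRiemannianMetric E M) (hP : SmoothEnd P) {c : ℝ}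
    (h : ∀ x v w, g.val x (P x v) w = c * g.val x v (P x w)) {x : M}
    (v y z : TangentSpace 𝓘(ℝ, E) x) :
    g.val x (covDerivEnd g P x v y) z = c * g.val x y (covDerivEnd g P x v z) := by
  have hY := contMDiffAt_extend_tangent y
  have hZ := contMDiffAt_extend_tangent z
  have hX := mdiffAt_of_contMDiffAt (contMDiffAt_extend_tangent v)
  have h1 := leviCivita_metric g hX (mdiffAt_of_contMDiffAt (hP.contMDiffAt_apply hY))
    (mdiffAt_of_contMDiffAt hZ)
  have h2 := leviCivita_metric g hX (mdiffAt_of_contMDiffAt hY)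
    (mdiffAt_of_contMDiffAt (hP.contMDiffAt_apply hZ))
  have h3 : d% (fun p ↦ g.val p (P p (extend E y p)) (extend E z p)) x v
      = c * d% (fun p ↦ g.val p (extend E y p) (P p (extend E z p))) x v := by
    have e : (fun p ↦ g.val p (P p (extend E y p)) (extend E z p))
        = (fun _ ↦ c) * fun p ↦ g.val p (extend E y p) (P p (extend E z p)) := by
      ext p
      simp [h]
    rw [e, mvfderiv_mul mdifferentiableAt_const (mdifferentiableAt_metric g
      (mdiffAt_of_contMDiffAt hY) (mdiffAt_of_contMDiffAt (hP.contMDiffAt_apply hZ))),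
      mvfderiv_const]
    simp
  simp only [extend_apply_self] at h1 h2
  rw [h1, h2] at h3
  have h4 := h x (leviCivita g (extend E y) x v) z
  have h5 := h x y (leviCivita g (extend E z) x v)
  simp only [covDerivEnd, map_sub, _root_.sub_apply]
  linear_combination h3 - h4 - h5

omit [FiniteDimensional ℝ E] in
theorem SmoothOneFormOn.contMDiffAt_apply {om : Π x : M, TangentSpace 𝓘(ℝ, E) x →L[ℝ] ℝ}
    {U : Set M} (hom : SmoothOneFormOn om U) {x : M} (hU : U ∈ 𝓝 x)
    {Y : Π x : M, TangentSpace 𝓘(ℝ, E) x} (hY : CMDiffAt ∞ (T% Y) x) :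
    CMDiffAt ∞ (fun p ↦ om p (Y p)) x := by
  have : ContMDiffAt 𝓘(ℝ, E) (𝓘(ℝ, E).prod 𝓘(ℝ)) ∞
      (fun m ↦ TotalSpace.mk' ℝ (E := Bundle.Trivial M ℝ) m (om m (Y m))) x := by
    apply ContMDiffAt.clm_bundle_apply (F₁ := E)
    · exact hom.contMDiffAt hU
    · exact hY
  simp only [contMDiffAt_totalSpace] at this
  exact this.2

/-- If `∇P = ω ⊗ Q` and `∇Q = c ω ⊗ P`, then `[R(u, v), P] = dω(u, v) Q`: the terms without
derivatives of `ω` are symmetric in `u` and `v`. -/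
theorem curvature_commutator (g : PseudoRiemannianMetric E M) (hP : SmoothEnd P)
    (hQ : SmoothEnd Q) {om : Π x : M, TangentSpace 𝓘(ℝ, E) x →L[ℝ] ℝ} {c : ℝ} {U : Set M} {x : M}
    (hom : SmoothOneFormOn om U) (hU : U ∈ 𝓝 x)
    (hPQ : ∀ p ∈ U, ∀ v y, covDerivEnd g P p v y = om p v • Q p y)
    (hQP : ∀ p ∈ U, ∀ v y, covDerivEnd g Q p v y = (c * om p v) • P p y)
    (u v w : TangentSpace 𝓘(ℝ, E) x) :
    curvature g x u v (P x w) - P x (curvature g x u v w)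
      = extDerivOneForm om x u v • Q x w := by
  have hZ := contMDiffAt_extend_tangent w
  have two (u v : TangentSpace 𝓘(ℝ, E) x) :
      leviCivita g (fun p ↦ leviCivita g (fun q ↦ P q (extend E w q)) p (extend E v p)) x u
        = d% (fun p ↦ om p (extend E v p)) x u • Q x w + (c * om x u * om x v) • P x w
          + (om x v • Q x (leviCivita g (extend E w) x u)
            + om x u • Q x (leviCivita g (extend E w) x v))
          + P x (leviCivita g (fun p ↦ leviCivita g (extend E w) p (extend E v p)) x u) := by
    have hY := contMDiffAt_extend_tangent v
    have hYZ := contMDiffAt_leviCivita g hY hZ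
    have hoY := hom.contMDiffAt_apply hU hY
    have hQZ := hQ.contMDiffAt_apply hZ
    have hPYZ := hP.contMDiffAt_apply hYZ
    have hoQ : CMDiffAt ∞ (T% ((fun p ↦ om p (extend E v p)) • fun p ↦ Q p (extend E w p))) x :=
      hoY.smul_section hQZ
    rw [leviCivita_congr g
        (Y' := ((fun p ↦ om p (extend E v p)) • fun p ↦ Q p (extend E w p))
          + fun p ↦ P p (leviCivita g (extend E w) p (extend E v p)))
        (mdiffAt_of_contMDiffAt (contMDiffAt_leviCivita g hY (hP.contMDiffAt_apply hZ)))
        (mdifferentiableAt_add_section (mdiffAt_of_contMDiffAt hoQ) (mdiffAt_of_contMDiffAt hPYZ))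
        _ u,
      leviCivita_add g (mdiffAt_of_contMDiffAt hoQ) (mdiffAt_of_contMDiffAt hPYZ),
      leviCivita_smul g (hoY.mdifferentiableAt (by simp)) (mdiffAt_of_contMDiffAt hQZ),
      leviCivita_end g hQ u (mdiffAt_of_contMDiffAt hZ),
      leviCivita_end g hP u (mdiffAt_of_contMDiffAt hYZ), hPQ x (mem_of_mem_nhds hU),
      hQP x (mem_of_mem_nhds hU)]
    · simp only [extend_apply_self]
      module
    filter_upwards [hU, eventually_mdifferentiableAt hZ] with p h1 h2
    rw [leviCivita_end g hP _ h2, hPQ p h1]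
    rfl
  have hR := curvatureField_extend g u v (hP.contMDiffAt_apply hZ)
  rw [extend_apply_self] at hR
  rw [← hR]
  simp only [curvature, curvatureField, extDerivOneForm, extend_apply_self, two]
  rw [leviCivita_end g hP _ (mdiffAt_of_contMDiffAt hZ), hPQ x (mem_of_mem_nhds hU)]
  simp only [map_sub, extend_apply_self]
  module

end Endomorphisms

/-! ### One-forms -/

section OneForm

variable {E : Type*} [NormedAddCommGroup E] [NormedSpace ℝ E] [FiniteDimensional ℝ E]
  {M : Type*} [TopologicalSpace M] [ChartedSpace E M] [IsManifold 𝓘(ℝ, E) ∞ M]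

/-- A 1-form is smooth if its values on smooth vector fields are smooth. -/
theorem contMDiffAt_oneForm {om : Π x : M, TangentSpace 𝓘(ℝ, E) x →L[ℝ] ℝ} {x : M}
    (h : ∀ W : Π x : M, TangentSpace 𝓘(ℝ, E) x, CMDiffAt ∞ (T% W) x →
      CMDiffAt ∞ (fun p ↦ om p (W p)) x) :
    ContMDiffAt 𝓘(ℝ, E) (𝓘(ℝ, E).prod 𝓘(ℝ, E →L[ℝ] ℝ)) ∞
      (fun x ↦ TotalSpace.mk' (E →L[ℝ] ℝ)
        (E := fun x : M ↦ (TangentSpace 𝓘(ℝ, E) x →L[ℝ] ℝ)) x (om x)) x := by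
  let e := trivializationAt E (TangentSpace 𝓘(ℝ, E) : M → Type _) x
  have hx : x ∈ e.baseSet := mem_baseSet_trivializationAt E _ x
  let b := Module.finBasis ℝ E
  let c (i) : E →L[ℝ] ℝ := LinearMap.toContinuousLinearMap (b.coord i)
  have hs : CMDiffAt ∞ (fun p ↦ ∑ i, om p (e.localFrame b i p) • c i) x :=
    ContMDiffAt.sum fun i _ ↦ (h _ (contMDiffAt_localFrame_of_mem ∞ e b i hx)).smul
      contMDiffAt_const
  refine (contMDiffAt_hom_bundle (E₂ := Bundle.Trivial M ℝ) _).2 ⟨contMDiffAt_id, ?_⟩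
  refine hs.congr_of_eventuallyEq ?_
  filter_upwards [e.open_baseSet.mem_nhds hx] with p hp
  have key : ∀ w : E, ∑ i, om p (e.localFrame b i p) • c i w = om p (e.symmL ℝ p w) := by
    intro w
    have hi (i) : e.localFrame b i p = e.symmL ℝ p (b i) := by
      simp [hp, Bundle.Trivialization.basisAt]
    simp only [hi, smul_eq_mul, mul_comm (om p _)]
    simp only [← smul_eq_mul, ← map_smul, ← map_sum]
    exact congrArg (fun w ↦ om p (e.symmL ℝ p w)) (b.sum_repr w)
  ext w
  simp only [_root_.sum_apply, _root_.smul_apply]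
  rw [key]
  simp [ContinuousLinearMap.inCoordinates, e]

theorem smoothOneFormOn_zero (U : Set M) :
    SmoothOneFormOn (0 : Π x : M, TangentSpace 𝓘(ℝ, E) x →L[ℝ] ℝ) U := fun _ _ ↦
  (contMDiffAt_oneForm fun _ _ ↦ contMDiffAt_const (c := (0 : ℝ))).contMDiffWithinAt

omit [FiniteDimensional ℝ E] in
theorem extDerivOneForm_eq_zero {om : Π x : M, TangentSpace 𝓘(ℝ, E) x →L[ℝ] ℝ} {x : M}
    (h : ∀ᶠ p in 𝓝 x, om p = 0) (u v : TangentSpace 𝓘(ℝ, E) x) :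
    extDerivOneForm om x u v = 0 := by
  have h0 (Y : Π x : M, TangentSpace 𝓘(ℝ, E) x) (v : TangentSpace 𝓘(ℝ, E) x) :
      d% (fun p ↦ om p (Y p)) x v = 0 := by
    have e : (fun p ↦ om p (Y p)) =ᶠ[𝓝 x] fun _ ↦ (0 : ℝ) := by
      filter_upwards [h] with p hp
      rw [hp, _root_.zero_apply]
    rw [mvfderiv_congr e, mvfderiv_const, _root_.zero_apply]
  rw [extDerivOneForm, h0, h0, h.self_of_nhds, _root_.zero_apply, sub_zero, sub_zero]

end OneForm

/-! ### The associated forms of a quaternionic Kähler structure -/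

namespace NHStructure

variable {E : Type*} [NormedAddCommGroup E] [NormedSpace ℝ E]
  {M : Type*} [TopologicalSpace M] [ChartedSpace E M] [IsManifold 𝓘(ℝ, E) ∞ M]
  (S : NHStructure E M) (x : M) (v w : TangentSpace 𝓘(ℝ, E) x)

theorem J_J_self (α : Fin 3) : S.J α x (S.J α x v) = -v := congr($(S.J_sq α x) v)

theorem J_one_two : S.J 1 x (S.J 2 x v) = S.J 0 x v := congr($(S.J_eq_comp 0 x) v).symm

theorem J_two_zero : S.J 2 x (S.J 0 x v) = S.J 1 x v := congr($(S.J_eq_comp 1 x) v).symm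

theorem J_zero_one : S.J 0 x (S.J 1 x v) = S.J 2 x v := congr($(S.J_eq_comp 2 x) v).symm

theorem J_two_one : S.J 2 x (S.J 1 x v) = -S.J 0 x v :=
  neg_eq_iff_eq_neg.1 congr($(S.J_eq_neg_comp 0 x) v).symm

theorem J_zero_two : S.J 0 x (S.J 2 x v) = -S.J 1 x v :=
  neg_eq_iff_eq_neg.1 congr($(S.J_eq_neg_comp 1 x) v).symm

/-- `J 0` is skew-adjoint, in the form required by `val_covDerivEnd`. -/
theorem val_J_zero : S.g.val x (S.J 0 x v) w = -1 * S.g.val x v (S.J 0 x w) := by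
  rw [S.hermitian, J_J_self, map_neg, _root_.neg_apply, neg_one_mul]

/-- `J 1` and `J 2` are self-adjoint, in the form required by `val_covDerivEnd`. -/
theorem val_J_of_norden (α : Fin 3) (hα : α = 1 ∨ α = 2) :
    S.g.val x (S.J α x v) w = 1 * S.g.val x v (S.J α x w) := by
  rw [S.norden α hα, J_J_self, map_neg, _root_.neg_apply, neg_neg, one_mul]

variable {S x v}

/-- `J 1 v` and `J 2 v` are linearly independent if `v ≠ 0`. -/
theorem eq_zero_of_smul_add_smul {a b : ℝ} (hv : v ≠ 0)
    (h : a • S.J 1 x v + b • S.J 2 x v = 0) : a = 0 ∧ b = 0 := by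
  have h1 := congrArg (fun z ↦ a • S.J 1 x z + b • S.J 2 x z) h
  simp only [map_add, map_smul, J_J_self, J_one_two, J_two_one, map_zero, smul_zero] at h1
  have h2 : (a ^ 2 + b ^ 2) • v = 0 := by
    rw [← neg_eq_zero, ← add_zero (0 : TangentSpace 𝓘(ℝ, E) x), ← h1]
    module
  have h3 := (smul_eq_zero.1 h2).resolve_right hv
  constructor <;> nlinarith [sq_nonneg a, sq_nonneg b]

theorem eq_zero_of_smul_J {α : Fin 3} {a : ℝ} (hv : v ≠ 0) (h : a • S.J α x v = 0) : a = 0 := by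
  refine (smul_eq_zero.1 h).resolve_right fun h0 ↦ hv ?_
  have := S.J_J_self x v α
  rw [h0, map_zero] at this
  exact neg_eq_zero.1 this.symm

/-- The self-adjoint components of a skew-adjoint endomorphism in the span of the `J α` vanish. -/
theorem eq_zero_of_skew {a : Fin 3 → ℝ} (hv : v ≠ 0)
    (h : ∀ y z, S.g.val x (∑ β, a β • S.J β x y) z = -1 * S.g.val x y (∑ β, a β • S.J β x z)) :
    a 1 = 0 ∧ a 2 = 0 := by
  refine eq_zero_of_smul_add_smul (S := S) hv (S.g.nondegenerate x _ fun z ↦ ?_)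
  have h1 := h v z
  simp only [Fin.sum_univ_three, map_add, map_smul, _root_.add_apply, _root_.smul_apply,
    smul_eq_mul, val_J_zero, S.val_J_of_norden x _ _ 1 (.inl rfl),
    S.val_J_of_norden x _ _ 2 (.inr rfl)] at h1 ⊢
  linarith

/-- The skew-adjoint component of a self-adjoint endomorphism in the span of the `J α` vanishes. -/
theorem eq_zero_of_selfAdjoint {a : Fin 3 → ℝ} (hv : v ≠ 0)
    (h : ∀ y z, S.g.val x (∑ β, a β • S.J β x y) z = 1 * S.g.val x y (∑ β, a β • S.J β x z)) :
    a 0 = 0 := by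
  refine eq_zero_of_smul_J (S := S) (α := 0) hv (S.g.nondegenerate x _ fun z ↦ ?_)
  have h1 := h v z
  simp only [Fin.sum_univ_three, map_add, map_smul, _root_.add_apply, _root_.smul_apply,
    smul_eq_mul, val_J_zero, S.val_J_of_norden x _ _ 1 (.inl rfl),
    S.val_J_of_norden x _ _ 2 (.inr rfl)] at h1 ⊢
  linarith

variable [FiniteDimensional ℝ E]

/-- The derivative of `(J α) ^ 2 = -1`. -/
theorem covDerivEnd_J_sq (α : Fin 3) (u y : TangentSpace 𝓘(ℝ, E) x) :
    covDerivEnd S.g (S.J α) x u (S.J α x y) + S.J α x (covDerivEnd S.g (S.J α) x u y) = 0 := by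
  rw [← covDerivEnd_comp S.g (S.smooth_J α) (S.smooth_J α)]
  have : (fun p ↦ (S.J α p).comp (S.J α p)) = fun _ ↦ -ContinuousLinearMap.id ℝ _ :=
    funext (S.J_sq α)
  rw [this, covDerivEnd_neg_id]

/-- For a quaternionic Kähler structure `J 0` is parallel: its derivative is skew-adjoint, hence a
multiple of `J 0` as `J 1` and `J 2` are self-adjoint, and `J 0 ^ 2 = -1` makes the factor vanish.
The derivatives of `J 1` and `J 2` in a given direction are then determined by a single number. -/
theorem IsQuaternionicKahler.covDerivEnd_eq (hS : S.IsQuaternionicKahler) (hv : v ≠ 0)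
    (u : TangentSpace 𝓘(ℝ, E) x) :
    (∀ y, covDerivEnd S.g (S.J 0) x u y = 0) ∧
      ∃ t : ℝ, ∀ y, covDerivEnd S.g (S.J 1) x u y = t • S.J 2 x y ∧
        covDerivEnd S.g (S.J 2) x u y = -(t • S.J 1 x y) := by
  obtain ⟨a, ha⟩ := hS 0 x u
  obtain ⟨b, hb⟩ := hS 1 x u
  have hI : ∀ y, covDerivEnd S.g (S.J 0) x u y = 0 := by
    obtain ⟨h1, h2⟩ := eq_zero_of_skew (a := a) hv fun y z ↦ by
      rw [← ha, ← ha, val_covDerivEnd S.g (S.smooth_J 0) (S.val_J_zero)]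
    simp only [Fin.sum_univ_three, h1, h2, zero_smul, add_zero] at ha
    have h3 := covDerivEnd_J_sq (S := S) 0 u v
    rw [ha, ha, map_smul, ← two_smul ℝ, smul_smul, J_J_self, smul_neg, neg_eq_zero] at h3
    have h4 := (smul_eq_zero.1 h3).resolve_right hv
    have h5 : a 0 = 0 := by linarith
    intro y
    rw [ha, h5, zero_smul]
  refine ⟨hI, b 2, fun y ↦ ?_⟩
  have h0 := eq_zero_of_selfAdjoint (a := b) hv fun y z ↦ by
    rw [← hb, ← hb, val_covDerivEnd S.g (S.smooth_J 1)
      (fun x v w ↦ S.val_J_of_norden x v w 1 (.inl rfl))]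
  simp only [Fin.sum_univ_three, h0, zero_smul, zero_add] at hb
  have h1 : b 1 = 0 := by
    have h3 := covDerivEnd_J_sq (S := S) 1 u v
    rw [hb, hb, map_add, map_smul, map_smul, J_J_self, J_two_one, J_one_two] at h3
    have h4 : (b 1) • v = 0 := by
      rw [← smul_zero (-1 / 2 : ℝ), ← h3]
      module
    exact (smul_eq_zero.1 h4).resolve_right hv
  simp only [h1, zero_smul, zero_add] at hb
  refine ⟨hb y, ?_⟩
  have : S.J 2 = fun p ↦ (S.J 0 p).comp (S.J 1 p) := funext (S.J_eq_comp 2)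
  conv_lhs => rw [this]
  rw [covDerivEnd_comp S.g (S.smooth_J 0) (S.smooth_J 1), hI, zero_add, hb, map_smul, J_zero_two,
    smul_neg]

/-- Associated forms exist locally: the form with index `0` is `g(Z, (∇J 1) Y) / g(Z, J 2 Y)` for
suitable local vector fields `Y` and `Z`, and the other two forms vanish. -/
theorem IsQuaternionicKahler.exists_isAssociatedForms [Nontrivial E]
    (hS : S.IsQuaternionicKahler) (p : M) :
    ∃ U : Set M, IsOpen U ∧ p ∈ U ∧
      ∃ om : Fin 3 → Π x : M, TangentSpace 𝓘(ℝ, E) x →L[ℝ] ℝ, S.IsAssociatedForms U om := by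
  have hne (x : M) : ∃ y : TangentSpace 𝓘(ℝ, E) x, y ≠ 0 := exists_ne (α := E) 0
  obtain ⟨y, hy⟩ := hne p
  obtain ⟨z, hz⟩ : ∃ z, S.g.val p (S.J 2 p y) z ≠ 0 := by
    by_contra! hc
    have h0 := S.J_J_self p y 2
    rw [S.g.nondegenerate p _ hc, map_zero] at h0
    exact hy (neg_eq_zero.1 h0.symm)
  let Y := extend E y
  let Z := extend E z
  let D (q : M) : ℝ := S.g.val q (Z q) (S.J 2 q (Y q))
  have hD : CMDiffAt ∞ D p := contMDiffAt_metric S.g (contMDiffAt_extend_tangent z)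
    ((S.smooth_J 2).contMDiffAt_apply (contMDiffAt_extend_tangent y))
  have hDp : D p ≠ 0 := by
    simp only [D, Y, Z, extend_apply_self]
    rwa [S.g.symm]
  obtain ⟨U, hU, hUo, hpU⟩ := eventually_nhds_iff.1 ((hD.continuousAt.eventually_ne hDp).and
    ((eventually_contMDiffAt_extend y).and (eventually_contMDiffAt_extend z)))
  let om (q : M) : TangentSpace 𝓘(ℝ, E) q →L[ℝ] ℝ :=
    (D q)⁻¹ • ((S.g.val q (Z q)).comp (leviCivita S.g (fun r ↦ S.J 1 r (Y r)) q)
      - (S.g.val q (S.J 1 q (Z q))).comp (leviCivita S.g Y q))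
  refine ⟨U, hUo, hpU, ![om, 0, 0], ?_, ?_⟩
  · have hom : SmoothOneFormOn om U := by
      intro q hq
      obtain ⟨h1, h2, h3⟩ := hU q hq
      refine (contMDiffAt_oneForm fun W hW ↦ ?_).contMDiffWithinAt
      have hD' : CMDiffAt ∞ D q :=
        contMDiffAt_metric S.g h3 ((S.smooth_J 2).contMDiffAt_apply h2)
      exact (hD'.inv₀ h1).mul ((contMDiffAt_metric S.g h3
        (contMDiffAt_leviCivita S.g hW ((S.smooth_J 1).contMDiffAt_apply h2))).sub
        (contMDiffAt_metric S.g ((S.smooth_J 1).contMDiffAt_apply h3)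
          (contMDiffAt_leviCivita S.g hW h2)))
    intro α
    fin_cases α
    exacts [hom, smoothOneFormOn_zero U, smoothOneFormOn_zero U]
  · intro α q hq u w
    obtain ⟨h1, h2, h3⟩ := hU q hq
    obtain ⟨v, hv⟩ := hne q
    obtain ⟨hI, t, ht⟩ := hS.covDerivEnd_eq hv u
    have hom : om q u = t := by
      have e := NHManifold.covDerivEnd_eq S.g (S.smooth_J 1) u (mdiffAt_of_contMDiffAt h2)
      rw [(ht _).1] at e
      have e' := congrArg (S.g.val q (Z q)) e
      have e'' := S.val_J_of_norden q (Z q) (leviCivita S.g Y q u) 1 (.inl rfl)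
      rw [map_smul, map_sub, smul_eq_mul] at e'
      change (D q)⁻¹ * (S.g.val q (Z q) (leviCivita S.g (fun r ↦ S.J 1 r (Y r)) q u)
        - S.g.val q (S.J 1 q (Z q)) (leviCivita S.g Y q u)) = t
      rw [e'', one_mul, ← e', inv_mul_eq_div]
      exact mul_div_cancel_right₀ t h1
    fin_cases α
    · change _ = (0 : ℝ) • S.J 1 q w - (0 : ℝ) • S.J 2 q w
      rw [zero_smul, zero_smul, sub_zero]
      exact hI w
    · change _ = om q u • S.J 2 q w - (0 : ℝ) • S.J 0 q w
      rw [zero_smul, sub_zero, hom]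
      exact (ht w).1
    · change _ = (0 : ℝ) • S.J 0 q w - om q u • S.J 1 q w
      rw [zero_smul, zero_sub, hom]
      exact (ht w).2

theorem isQuaternionicKahler_of_forms (h : ∀ p : M, ∃ U : Set M, IsOpen U ∧ p ∈ U ∧
      ∃ om : Fin 3 → Π x : M, TangentSpace 𝓘(ℝ, E) x →L[ℝ] ℝ, S.IsAssociatedForms U om) :
    S.IsQuaternionicKahler := by
  intro α x u
  obtain ⟨U, -, hxU, om, hom⟩ := h x
  refine ⟨Pi.single (α + 1) (om (α + 2) x u) - Pi.single (α + 2) (om (α + 1) x u), fun y ↦ ?_⟩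
  rw [hom.nabla_J α x hxU]
  simp [sub_smul, Finset.sum_sub_distrib, Pi.single_apply, ite_smul]

/-- The associated forms with indices `1` and `2` vanish: `∇J_0 = ω_2 J_1 - ω_1 J_2` is
skew-adjoint, while `J_1` and `J_2` are self-adjoint. -/
theorem IsAssociatedForms.eq_zero [Nontrivial E] {U : Set M}
    {om : Fin 3 → Π x : M, TangentSpace 𝓘(ℝ, E) x →L[ℝ] ℝ} (h : S.IsAssociatedForms U om)
    (hx : x ∈ U) (u : TangentSpace 𝓘(ℝ, E) x) : om 1 x u = 0 ∧ om 2 x u = 0 := by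
  obtain ⟨v, hv⟩ : ∃ v : TangentSpace 𝓘(ℝ, E) x, v ≠ 0 := exists_ne (α := E) 0
  have ha (y) : covDerivEnd S.g (S.J 0) x u y
      = ∑ β, (![0, om 2 x u, -om 1 x u] : Fin 3 → ℝ) β • S.J β x y := by
    rw [h.nabla_J 0 x hx]
    simp [Fin.sum_univ_three, sub_eq_add_neg]
  have := eq_zero_of_skew (S := S) (a := ![0, om 2 x u, -om 1 x u]) hv fun y z ↦ by
    rw [← ha, ← ha, val_covDerivEnd S.g (S.smooth_J 0) (S.val_J_zero)]
  simpa [and_comm] using this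

theorem IsAssociatedForms.unique [Nontrivial E] {U : Set M}
    {om om' : Fin 3 → Π x : M, TangentSpace 𝓘(ℝ, E) x →L[ℝ] ℝ}
    (h : S.IsAssociatedForms U om) (h' : S.IsAssociatedForms U om') (hx : x ∈ U) (α : Fin 3) :
    om' α x = om α x := by
  obtain ⟨v, hv⟩ : ∃ v : TangentSpace 𝓘(ℝ, E) x, v ≠ 0 := exists_ne (α := E) 0
  ext u
  obtain ⟨h1, h2⟩ := h.eq_zero hx u
  obtain ⟨h1', h2'⟩ := h'.eq_zero hx u
  fin_cases α
  · have e := (h'.nabla_J 1 x hx u v).symm.trans (h.nabla_J 1 x hx u v)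
    change om' 0 x u • S.J 2 x v - om' 2 x u • S.J 0 x v
      = om 0 x u • S.J 2 x v - om 2 x u • S.J 0 x v at e
    rw [h2, h2', zero_smul, sub_zero, sub_zero, ← sub_eq_zero, ← sub_smul] at e
    exact sub_eq_zero.1 (eq_zero_of_smul_J hv e)
  · exact h1'.trans h1.symm
  · exact h2'.trans h2.symm

/-- The derivative of the nonzero associated form, read off from the curvature: `R(u, v)` commutes
with the parallel `J 0`, and its commutator with `J 1` is `dω(u, v) J 2`. -/
theorem IsAssociatedForms.extDeriv_zero_eq {n : ℕ} (hn : 2 ≤ n)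
    (hdim : Module.finrank ℝ E = 4 * n) {U : Set M} (hU : IsOpen U)
    {om : Fin 3 → Π x : M, TangentSpace 𝓘(ℝ, E) x →L[ℝ] ℝ} (h : S.IsAssociatedForms U om)
    (hx : x ∈ U) (u v : TangentSpace 𝓘(ℝ, E) x) :
    extDerivOneForm (om 0) x u v
      = -(scalarCurvature S.g x / (4 * (n : ℝ) ^ 2) * S.g.val x (S.J 0 x u) v) := by
  have : Nontrivial E := Module.nontrivial_of_finrank_pos (R := ℝ) (by omega)
  have nI (p : M) (hp : p ∈ U) (v y : TangentSpace 𝓘(ℝ, E) p) :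
      covDerivEnd S.g (S.J 0) p v y = 0 := by
    have := h.nabla_J 0 p hp v y
    change _ = om 2 p v • S.J 1 p y - om 1 p v • S.J 2 p y at this
    rw [this, (h.eq_zero hp v).1, (h.eq_zero hp v).2]
    simp
  have nJ (p : M) (hp : p ∈ U) (v y : TangentSpace 𝓘(ℝ, E) p) :
      covDerivEnd S.g (S.J 1) p v y = om 0 p v • S.J 2 p y := by
    have := h.nabla_J 1 p hp v y
    change _ = om 0 p v • S.J 2 p y - om 2 p v • S.J 0 p y at this
    rw [this, (h.eq_zero hp v).2]
    simp
  have nK (p : M) (hp : p ∈ U) (v y : TangentSpace 𝓘(ℝ, E) p) :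
      covDerivEnd S.g (S.J 2) p v y = (-1 * om 0 p v) • S.J 1 p y := by
    have := h.nabla_J 2 p hp v y
    change _ = om 1 p v • S.J 0 p y - om 0 p v • S.J 1 p y at this
    rw [this, (h.eq_zero hp v).1]
    simp
  have hUx := hU.mem_nhds hx
  have : FiniteDimensional ℝ (TangentSpace 𝓘(ℝ, E) x) := inferInstanceAs (FiniteDimensional ℝ E)
  obtain ⟨c, hc, hric⟩ := (isCurvatureLike_curvature S.g x).exists_eq_smul_metric hn
    (I := (S.J 0 x).toLinearMap) (J := (S.J 1 x).toLinearMap) (K := (S.J 2 x).toLinearMap)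
    (Ω := extDerivOneForm (om 0) x) hdim (S.J_J_self x · 0) (S.J_J_self x · 1) (S.J_J_self x · 2)
    (S.J_one_two x) (S.J_two_one x) (S.J_zero_one x) (S.J_zero_two x) (S.J_two_zero x)
    (fun u v w ↦ by
      have := curvature_commutator S.g (S.smooth_J 0) (S.smooth_J 0) (c := 0)
        (smoothOneFormOn_zero U) hUx
        (fun p hp v y ↦ by simp [nI p hp]) (fun p hp v y ↦ by simp [nI p hp]) u v w
      rw [extDerivOneForm_eq_zero (om := 0) (.of_forall fun _ ↦ rfl), zero_smul] at this
      exact sub_eq_zero.1 this)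
    (curvature_commutator S.g (S.smooth_J 1) (S.smooth_J 2) (h.smooth 0) hUx nJ nK)
    (fun v w ↦ by simpa using S.val_J_zero x v w)
    (fun v w ↦ by simpa using S.val_J_of_norden x v w 1 (.inl rfl))
  have hτ := scalarCurvature_eq S.g x (a := -(n * c)) fun y z ↦ by
    rw [ricci_eq_ric]
    exact hric y z
  rw [hc, hτ, hdim]
  have : (n : ℝ) ≠ 0 := by positivity
  simp only [ContinuousLinearMap.coe_coe, metricForm_apply]
  push_cast
  field_simp

end NHStructure
end NHManifold
end

theorem proposition2p9 {E : Type*} [NormedAddCommGroup E] [NormedSpace ℝ E] [FiniteDimensional ℝ E]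
    {M : Type*} [TopologicalSpace M] [T2Space M] [ChartedSpace E M] [IsManifold 𝓘(ℝ, E) ∞ M]
    (n : ℕ) (hn : 2 ≤ n) (hdim : Module.finrank ℝ E = 4 * n) (S : NHManifold.NHStructure E M) :
    (S.IsQuaternionicKahler ↔
      ∀ p : M, ∃ U : Set M, IsOpen U ∧ p ∈ U ∧
        ∃ om : Fin 3 → Π x : M, TangentSpace 𝓘(ℝ, E) x →L[ℝ] ℝ, S.IsAssociatedForms U om) ∧
    ∀ (U : Set M), IsOpen U → ∀ om : Fin 3 → Π x : M, TangentSpace 𝓘(ℝ, E) x →L[ℝ] ℝ,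
      S.IsAssociatedForms U om →
        (∀ om' : Fin 3 → Π x : M, TangentSpace 𝓘(ℝ, E) x →L[ℝ] ℝ,
          S.IsAssociatedForms U om' → ∀ α, ∀ x ∈ U, om' α x = om α x) ∧
        ∀ x ∈ U, ∀ u v : TangentSpace 𝓘(ℝ, E) x,
          NHManifold.extDerivOneForm (om 1) x u v
            = -(om 2 x u * om 0 x v) + om 0 x u * om 2 x v ∧
          NHManifold.extDerivOneForm (om 2) x u v
            = -(om 0 x u * om 1 x v) + om 1 x u * om 0 x v ∧
          NHManifold.extDerivOneForm (om 0) x u v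
            = -(om 1 x u * om 2 x v) + om 2 x u * om 1 x v
              - NHManifold.scalarCurvature S.g x / (4 * (n : ℝ) ^ 2) * S.g.val x (S.J 0 x u) v := by
  have : Nontrivial E := Module.nontrivial_of_finrank_pos (R := ℝ) (by omega)
  refine ⟨⟨fun hS p ↦ hS.exists_isAssociatedForms p,
    NHManifold.NHStructure.isQuaternionicKahler_of_forms⟩, fun U hU om hom ↦
    ⟨fun om' hom' α x hx ↦ hom.unique hom' hx α, fun x hx u v ↦ ?_⟩⟩
  have hd (α : Fin 3) (hα : ∀ p ∈ U, ∀ v, om α p v = 0) :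
      NHManifold.extDerivOneForm (om α) x u v = 0 :=
    NHManifold.extDerivOneForm_eq_zero
      (Filter.eventually_of_mem (hU.mem_nhds hx) fun p hp ↦ by ext v; exact hα p hp v) u v
  refine ⟨?_, ?_, ?_⟩
  · simp [hd 1 fun p hp v ↦ (hom.eq_zero hp v).1, hom.eq_zero hx]
  · simp [hd 2 fun p hp v ↦ (hom.eq_zero hp v).2, hom.eq_zero hx]
  · rw [hom.extDeriv_zero_eq hn hdim hU hx]
    simp [hom.eq_zero hx]
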